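/- Let $\zeta$ be the Riemann zeta function and $\chi$ the nontrivial Dirichlet character modulo $4$, with $L$-function $L(s,\chi)$, so that $L(s,\chi)=\sum_{k\ge 0}(-1)^k(2k+1)^{-s}$ for $\Re s>0$. Let $\xi(s)=\frac{s(s-1)}{2}\pi^{-s/2}\Gamma(s/2)\zeta(s)$, which (after removing singularities) is an entire function, and let $\Xi(t)=\xi(\tfrac12+it)$ for $t\in\mathbb C$. Sums over $\Re\alpha>0$ run over all zeros $\alpha\in\mathbb C$ of $\Xi$ with positive real part, each repeated according to its multiplicity. Theorem. We have $\zeta(\tfrac12)\neq 0$, so that $\zeta'/\zeta$ is holomorphic near $s=\tfrac12$. For every odd integer $n\ge 3$, \[\frac{1}{(n-1)!\,2^{n-1}}\,\frac{d^{n-1}}{ds^{n-1}}\frac{\zeta'(s)}{\zeta(s)}\Big|_{s=\frac12}=\Bigl(1-\frac1{2^n}\Bigr)\zeta(n)+L(n,\chi).\] For every even integer $n\ge 2$, the series $\sum_{\Re\alpha>0}\frac{4}{\alpha^n}$ converges absolutely and \[\frac{1}{(n-1)!\,2^{n-1}}\,\frac{d^{n-1}}{ds^{n-1}}\frac{\zeta'(s)}{\zeta(s)}\Big|_{s=\frac12}=4-\frac{(-1)^{n/2}}{2^n}\sum_{\Re\alpha>0}\frac{4}{\alpha^n}-L(n,\chi)-\Bigl(1-\frac1{2^n}\Bigr)\zeta(n).\]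 -/

import Mathlib

/-- Riemann's function `ξ(s) = s(s-1)/2 · π^{-s/2} Γ(s/2) ζ(s)` as an entire function. It is written
through Mathlib's entire function `Λ₀(s) = π^{-s/2} Γ(s/2) ζ(s) + 1/s + 1/(1-s)`, so that it has the
right value at the removable singularities too; see `riemannXi_eq`. -/
noncomputable def riemannXi (s : ℂ) : ℂ :=
  (s * (s - 1) * completedRiemannZeta₀ s + 1) / 2

/-- The usual formula for `ξ`, wherever each of its factors is finite. -/
theorem riemannXi_eq (s : ℂ) (h1 : s ≠ 1) (hs : ∀ k : ℕ, s ≠ -(2 * (k : ℂ))) :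
    riemannXi s =
      s * (s - 1) / 2 * (Real.pi : ℂ) ^ (-s / 2) * Complex.Gamma (s / 2) * riemannZeta s := by
  have h0 : s ≠ 0 := by simpa using hs 0
  have hG : s.Gammaℝ ≠ 0 := by
    rw [Ne, Complex.Gammaℝ_eq_zero_iff]
    push Not
    exact hs
  have h1' : (1 : ℂ) - s ≠ 0 := sub_ne_zero.mpr (Ne.symm h1)
  have h2 : s * (s - 1) / 2 * (Real.pi : ℂ) ^ (-s / 2) * Complex.Gamma (s / 2) * riemannZeta s
      = s * (s - 1) / 2 * (s.Gammaℝ * riemannZeta s) := by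
    rw [Complex.Gammaℝ_def]; ring
  rw [h2, riemannZeta_def_of_ne_zero h0, mul_div_cancel₀ _ hG, completedRiemannZeta_eq, riemannXi]
  field_simp
  ring

theorem differentiable_riemannXi : Differentiable ℂ riemannXi := by
  have := differentiable_completedZeta₀
  unfold riemannXi
  fun_prop

/-- `Ξ(t) = ξ(1/2 + i t)`. -/
noncomputable def capitalXi (t : ℂ) : ℂ := riemannXi (1 / 2 + Complex.I * t)

theorem differentiable_capitalXi : Differentiable ℂ capitalXi := by
  have := differentiable_riemannXi
  unfold capitalXi
  fun_prop

/-- `Ξ` is not identically zero near any point, so all its zeros have finite multiplicity. -/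
theorem analyticOrderAt_capitalXi_ne_top (t : ℂ) : analyticOrderAt capitalXi t ≠ ⊤ := by
  have hA : AnalyticOnNhd ℂ capitalXi Set.univ :=
    differentiable_capitalXi.differentiableOn.analyticOnNhd isOpen_univ
  intro h
  rw [analyticOrderAt_eq_top] at h
  have h0 := hA.eqOn_zero_of_preconnected_of_eventuallyEq_zero isPreconnected_univ
    (Set.mem_univ t) h (Set.mem_univ (Complex.I / 2))
  have e : (1 / 2 + Complex.I * (Complex.I / 2) : ℂ) = 0 := by
    linear_combination (1 / 2 : ℂ) * Complex.I_mul_I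
  simp only [capitalXi, e, riemannXi, Pi.zero_apply] at h0
  norm_num at h0

/-- The zeros `α` of `Ξ` with `Re α > 0`, each repeated according to its multiplicity. -/
abbrev PosXiZeros : Type :=
  Σ α : {α : ℂ // capitalXi α = 0 ∧ 0 < α.re}, Fin (analyticOrderNatAt capitalXi (α : ℂ))

/-- The nontrivial Dirichlet character modulo 4, with complex values. -/
noncomputable abbrev chi4 : DirichletCharacter ℂ 4 :=
  ZMod.χ₄.ringHomComp (Int.castRingHom ℂ)

/-! Taking logarithmic derivatives in ξ(s) = s(s-1)/2 · Γℝ(s) ζ(s) writes ζ'/ζ near 1/2 as ξ'/ξ -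
1/s - 1/(s-1) + (log π)/2 - ψ(s/2)/2, with ψ the digamma function. Differentiate n-1 ≥ 1 times at
1/2. The constant disappears; the two poles, at opposite distances from 1/2, cancel for odd n and
give the term 4 for even n. Gauss's product for Γ turns ψ^(n-1)(1/4) into a multiple of Σ
1/(4k+1)^n, which is the average of (1-2^{-n})ζ(n), the sum over all odd integers, and L(n,χ)
(`iteratedDeriv_digamma_one_div_four`).

There remains ξ'/ξ. The functional equation makes Ξ even, so Ξ'/Ξ is odd and contributes nothing for
odd n. For even n its derivative at 0 is a power sum over the zeros
(`hasSum_iteratedDeriv_logDeriv`). This needs no Hadamard product: divide an entire f by its zeros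
in |z| ≤ R. On |z| = 3R each removed linear factor has modulus at least 2, so the maximum principle
bounds both the number of zeros and the quotient h. Since h has no zeros in |z| < R,
Borel–Carathéodory and Cauchy's estimate bound the derivatives of h'/h at 0, and these tend to 0 as
R → ∞ once n exceeds the order of f.

For Ξ the order bound 3/2 suffices, as n ≥ 2. It comes from ξ(s) = (s/2) Γℝ(s) (s - s(s-1) ∫₁^∞ {t}
t^{-s-1} dt) on Re s > 0, and the same formula excludes zeros of ξ on (0, 1]. Hence ξ has no real
zeros (`riemannXi_ofReal_ne_zero`), so ζ(1/2) ≠ 0 and no zero of Ξ is purely imaginary; the zeros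
with Re α > 0 therefore carry exactly half of any even sum. -/

open Complex Filter Topology Metric MeasureTheory

/-! ### Polygamma functions from Gauss's product for Γ -/

/-- Pointwise limits of uniformly bounded holomorphic functions commute with derivatives. -/
theorem tendsto_iteratedDeriv_of_tendsto_of_bounded {F : ℕ → ℂ → ℂ} {f : ℂ → ℂ} {c : ℂ} {R M : ℝ}
    (hR : 0 < R) (hF : ∀ᶠ n in atTop, DifferentiableOn ℂ (F n) (closedBall c R))
    (hf : DifferentiableOn ℂ f (closedBall c R))
    (hM : ∀ᶠ n in atTop, ∀ z ∈ closedBall c R, ‖F n z‖ ≤ M)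
    (hlim : ∀ z ∈ closedBall c R, Tendsto (fun n => F n z) atTop (𝓝 (f z))) (m : ℕ) :
    Tendsto (fun n => iteratedDeriv m (F n) c) atTop (𝓝 (iteratedDeriv m f c)) := by
  -- Cauchy's formula turns derivatives into circle integrals, where pointwise limits and a uniform
  -- bound suffice for dominated convergence.
  have key : ∀ g : ℂ → ℂ, DifferentiableOn ℂ g (closedBall c R) →
      iteratedDeriv m g c = (2 * Real.pi * I / m.factorial)⁻¹ *
        ∮ z in C(c, R), (1 / (z - c) ^ (m + 1)) • g z := by
    intro g hg
    have h0 : (2 * Real.pi * I / m.factorial : ℂ) ≠ 0 := by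
      simp [Real.pi_ne_zero, m.factorial_ne_zero]
    rw [hg.circleIntegral_one_div_sub_center_pow_smul hR m, smul_eq_mul, inv_mul_cancel_left₀ h0]
  rw [key f hf]
  refine Tendsto.congr' (hF.mono fun n hn => (key (F n) hn).symm) (Tendsto.const_mul _ ?_)
  have hmem : ∀ θ : ℝ, circleMap c R θ ∈ closedBall c R := fun θ =>
    circleMap_mem_closedBall c hR.le θ
  have hne : ∀ θ : ℝ, circleMap c R θ - c ≠ 0 := fun θ =>
    sub_ne_zero.mpr (circleMap_ne_center hR.ne')
  refine intervalIntegral.tendsto_integral_filter_of_dominated_convergence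
    (fun _ => |R| * ((R ^ (m + 1))⁻¹ * M)) ?_ ?_ intervalIntegrable_const ?_
  · filter_upwards [hF] with n hn
    refine Continuous.aestronglyMeasurable ?_
    have h1 : Continuous fun θ => F n (circleMap c R θ) :=
      hn.continuousOn.comp_continuous (continuous_circleMap c R) hmem
    have h2 : Continuous fun θ => 1 / (circleMap c R θ - c) ^ (m + 1) :=
      continuous_const.div (((continuous_circleMap c R).sub continuous_const).pow _)
        fun θ => pow_ne_zero _ (hne θ)
    have h3 : Continuous fun θ => deriv (circleMap c R) θ := by
      simp only [deriv_circleMap]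
      exact (continuous_circleMap 0 R).mul continuous_const
    exact h3.smul (h2.smul h1)
  · filter_upwards [hM] with n hn
    refine Eventually.of_forall fun θ _ => ?_
    have h := hn _ (hmem θ)
    have h4 : ‖circleMap c R θ - c‖ = R := by
      have := circleMap_mem_sphere c hR.le θ
      rwa [mem_sphere_iff_norm] at this
    rw [norm_smul, norm_smul, norm_div, norm_pow, h4, norm_one, one_div]
    have h5 : ‖deriv (circleMap c R) θ‖ = |R| := by simp [deriv_circleMap]
    rw [h5]
    gcongr
  · exact Eventually.of_forall fun θ _ => ((hlim _ (hmem θ)).const_smul _).const_smul _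

theorem iteratedDeriv_inv_add (m : ℕ) (a c : ℂ) :
    iteratedDeriv m (fun z => (z + c)⁻¹) a = (-1) ^ m * m.factorial * (1 / (a + c) ^ (m + 1)) := by
  have h := congrFun (iter_deriv_inv_linear m (1 : ℂ) c) a
  rw [iteratedDeriv_eq_iterate]
  simp only [one_mul, one_pow, mul_one] at h
  rw [h, show (-1 - m : ℤ) = -((m + 1 : ℕ) : ℤ) by push_cast; ring, zpow_neg, zpow_natCast, one_div]

/-- The partial sums of the Gauss series of the digamma function. -/
noncomputable def digammaSeq (n : ℕ) (z : ℂ) : ℂ :=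
  Complex.log n - ∑ j ∈ Finset.range (n + 1), (z + j)⁻¹

theorem add_natCast_ne_zero {z : ℂ} (hz : 0 < z.re) (j : ℕ) : z + j ≠ 0 := by
  intro h
  have := congrArg Complex.re h
  simp at this
  have h2 : (0 : ℝ) ≤ j := j.cast_nonneg
  linarith

theorem hasDerivAt_GammaSeq {n : ℕ} (hn : n ≠ 0) {z : ℂ} (hz : 0 < z.re) :
    HasDerivAt (fun w => GammaSeq w n) (GammaSeq z n * digammaSeq n z) z := by
  have hn' : (n : ℂ) ≠ 0 := Nat.cast_ne_zero.mpr hn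
  have h1 : HasDerivAt (fun w : ℂ => (n : ℂ) ^ w) ((n : ℂ) ^ z * Complex.log n) z := by
    simpa using (hasDerivAt_id z).const_cpow (Or.inl hn')
  have hne : ∀ j ∈ Finset.range (n + 1), z + j ≠ 0 := fun j _ => add_natCast_ne_zero hz j
  have hP : (∏ j ∈ Finset.range (n + 1), (z + j)) ≠ 0 := Finset.prod_ne_zero_iff.mpr hne
  have h2 : HasDerivAt (fun w : ℂ => ∏ j ∈ Finset.range (n + 1), (w + j))
      ((∏ j ∈ Finset.range (n + 1), (z + j)) * ∑ j ∈ Finset.range (n + 1), (z + j)⁻¹) z := by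
    have hd : DifferentiableAt ℂ (fun w : ℂ => ∏ j ∈ Finset.range (n + 1), (w + j)) z := by fun_prop
    have hl := logDeriv_prod (x := z) (s := Finset.range (n + 1)) (f := fun (j : ℕ) (w : ℂ) => w + j)
      hne (fun j _ => by fun_prop)
    have : deriv (fun w : ℂ => ∏ j ∈ Finset.range (n + 1), (w + j)) z =
        (∏ j ∈ Finset.range (n + 1), (z + j)) * ∑ j ∈ Finset.range (n + 1), (z + j)⁻¹ := by
      rw [logDeriv_apply, div_eq_iff hP] at hl
      rw [hl, mul_comm]
      congr 1
      refine Finset.sum_congr rfl fun j _ => ?_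
      simp [logDeriv_apply]
    rw [← this]
    exact hd.hasDerivAt
  have h3 := (h1.mul_const (n.factorial : ℂ)).div h2 hP
  refine h3.congr_deriv ?_
  simp only [GammaSeq, digammaSeq]
  field_simp

/-- Since |z + j| ≥ Re z + j, the modulus is at most the value of the same product at Re z, and
log-convexity of the real Γ (Bohr–Mollerup) bounds that by Γ(Re z). This is the uniform bound that
lets the limit defining Γ be differentiated. -/
theorem norm_GammaSeq_le {n : ℕ} (hn : n ≠ 0) {z : ℂ} (hz : 0 < z.re) :
    ‖GammaSeq z n‖ ≤ Real.Gamma z.re := by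
  have hn' : 0 < n := Nat.pos_of_ne_zero hn
  have h1 : ‖GammaSeq z n‖ ≤ Real.exp (Real.BohrMollerup.logGammaSeq z.re n) := by
    rw [GammaSeq, norm_div, norm_mul, norm_prod, Real.BohrMollerup.logGammaSeq, Real.exp_sub,
      Real.exp_add, Real.exp_sum, Real.exp_log (by positivity : (0 : ℝ) < n.factorial),
      norm_natCast_cpow_of_pos hn', norm_natCast, mul_comm z.re,
      Real.rpow_def_of_pos (by positivity)]
    have hj : ∀ j : ℕ, 0 < z.re + j := fun j => by positivity
    refine div_le_div_of_nonneg_left (by positivity)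
      (Finset.prod_pos fun j _ => Real.exp_pos _) ?_
    refine Finset.prod_le_prod (fun j _ => (Real.exp_pos _).le) fun j _ => ?_
    rw [Real.exp_log (hj j)]
    calc z.re + j = (z + j).re := by simp
      _ ≤ _ := re_le_norm _
  have h2 := Real.BohrMollerup.ge_logGammaSeq (f := Real.log ∘ Real.Gamma) Real.convexOn_log_Gamma
    (fun {y} hy => by
      simp only [Function.comp]
      rw [Real.Gamma_add_one hy.ne', Real.log_mul hy.ne' (Real.Gamma_pos_of_pos hy).ne', add_comm])
    hz hn
  simp only [Function.comp, Real.Gamma_one, Real.log_one, zero_add] at h2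
  calc _ ≤ _ := h1
    _ ≤ Real.exp (Real.log (Real.Gamma z.re)) := Real.exp_le_exp.mpr h2
    _ = _ := Real.exp_log (Real.Gamma_pos_of_pos hz)

theorem re_pos_of_mem_closedBall {a z : ℂ} (ha : 0 < a.re) (hz : z ∈ closedBall a (a.re / 2)) :
    a.re / 2 ≤ z.re ∧ z.re ≤ 2 * a.re := by
  rw [mem_closedBall_iff_norm] at hz
  have := (abs_re_le_norm (z - a)).trans hz
  rw [sub_re, abs_le] at this
  constructor <;> linarith

theorem differentiableAt_Gamma_of_re_pos {z : ℂ} (hz : 0 < z.re) : DifferentiableAt ℂ Gamma z :=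
  differentiableAt_Gamma z fun m h => add_natCast_ne_zero hz m (by rw [h]; ring)

theorem tendsto_digammaSeq {a : ℂ} (ha : 0 < a.re) :
    Tendsto (fun n => digammaSeq n a) atTop (𝓝 (digamma a)) := by
  have hball : ∀ z ∈ closedBall a (a.re / 2), 0 < z.re := fun z hz =>
    (half_pos ha).trans_le (re_pos_of_mem_closedBall ha hz).1
  obtain ⟨M, hM⟩ : ∃ M, ∀ x ∈ Set.Icc (a.re / 2) (2 * a.re), Real.Gamma x ≤ M := by
    have hc : ContinuousOn Real.Gamma (Set.Icc (a.re / 2) (2 * a.re)) := fun x hx =>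
      (Real.differentiableAt_Gamma fun m => by
        have h1 : (0 : ℝ) ≤ m := m.cast_nonneg
        have h2 := hx.1
        intro h; linarith).continuousAt.continuousWithinAt
    obtain ⟨M, hM⟩ := isCompact_Icc.bddAbove_image hc
    exact ⟨M, fun x hx => hM ⟨x, hx, rfl⟩⟩
  have h1 : Tendsto (fun n => iteratedDeriv 1 (fun w => GammaSeq w n) a) atTop
      (𝓝 (iteratedDeriv 1 Gamma a)) := by
    refine tendsto_iteratedDeriv_of_tendsto_of_bounded (half_pos ha) (M := M) ?_ ?_ ?_ ?_ 1
    · filter_upwards [eventually_ne_atTop 0] with n hn z hz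
      exact (hasDerivAt_GammaSeq hn (hball z hz)).differentiableAt.differentiableWithinAt
    · exact fun z hz => (differentiableAt_Gamma_of_re_pos (hball z hz)).differentiableWithinAt
    · filter_upwards [eventually_ne_atTop 0] with n hn z hz
      exact (norm_GammaSeq_le hn (hball z hz)).trans (hM _ (re_pos_of_mem_closedBall ha hz))
    · exact fun z _ => GammaSeq_tendsto_Gamma z
  simp only [iteratedDeriv_one] at h1
  refine (h1.div (GammaSeq_tendsto_Gamma a) (Gamma_ne_zero_of_re_pos ha)).congr' ?_
  filter_upwards [eventually_ne_atTop 0,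
    (GammaSeq_tendsto_Gamma a).eventually_ne (Gamma_ne_zero_of_re_pos ha)] with n hn hne
  change deriv (fun w => GammaSeq w n) a / GammaSeq a n = _
  rw [(hasDerivAt_GammaSeq hn ha).deriv, mul_div_cancel_left₀ _ hne]

theorem differentiableOn_digamma : DifferentiableOn ℂ digamma {z | 0 < z.re} := by
  have ho : IsOpen {z : ℂ | 0 < z.re} := isOpen_lt continuous_const continuous_re
  have h : DifferentiableOn ℂ Gamma {z | 0 < z.re} := fun z hz =>
    (differentiableAt_Gamma_of_re_pos hz).differentiableWithinAt
  exact (h.deriv ho).div h fun z hz => Gamma_ne_zero_of_re_pos hz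

/-- Pointwise convergence is already known, so only a bound on a disc is missing. It comes from
comparison with the centre. -/
theorem tendsto_iteratedDeriv_digammaSeq {a : ℂ} (ha : 0 < a.re) (m : ℕ) :
    Tendsto (fun n => iteratedDeriv m (digammaSeq n) a) atTop (𝓝 (iteratedDeriv m digamma a)) := by
  set r := a.re / 2 with hr
  have hr0 : 0 < r := half_pos ha
  have hball : ∀ z ∈ closedBall a r, r ≤ z.re := fun z hz => (re_pos_of_mem_closedBall ha hz).1
  have hsum : Summable fun j : ℕ => r * (1 / |(j : ℝ) + r| ^ (2 : ℝ)) :=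
    ((Real.summable_one_div_nat_add_rpow r 2).mpr (by norm_num)).mul_left r
  obtain ⟨M, hM⟩ := (tendsto_digammaSeq ha).norm.bddAbove_range
  refine tendsto_iteratedDeriv_of_tendsto_of_bounded hr0
    (M := M + ∑' j : ℕ, r * (1 / |(j : ℝ) + r| ^ (2 : ℝ))) ?_ ?_ ?_ ?_ m
  · refine Eventually.of_forall fun n z hz => DifferentiableAt.differentiableWithinAt ?_
    have : ∀ j : ℕ, z + j ≠ 0 := add_natCast_ne_zero (hr0.trans_le (hball z hz))
    unfold digammaSeq
    refine (differentiableAt_const _).sub (DifferentiableAt.fun_sum fun j _ => ?_)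
    exact (differentiableAt_id.add_const _).inv (this j)
  · exact differentiableOn_digamma.mono fun z hz => hr0.trans_le (hball z hz)
  · refine Eventually.of_forall fun n z hz => ?_
    -- Subtracting the value at the centre removes the divergent log n and leaves terms of size
    -- O(1/j²).
    have e : digammaSeq n z =
        digammaSeq n a + ∑ j ∈ Finset.range (n + 1), ((a + j)⁻¹ - (z + j)⁻¹) := by
      simp only [digammaSeq, Finset.sum_sub_distrib]; ring
    rw [e]
    refine (norm_add_le _ _).trans (add_le_add (hM ⟨n, rfl⟩) ?_)
    refine (norm_sum_le _ _).trans (le_trans (Finset.sum_le_sum fun j _ => ?_)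
      (hsum.sum_le_tsum (Finset.range (n + 1)) fun j _ => by positivity))
    have hz0 : z + j ≠ 0 := add_natCast_ne_zero (hr0.trans_le (hball z hz)) j
    have ha0 : a + j ≠ 0 := add_natCast_ne_zero ha j
    have hj : (0 : ℝ) < j + r := by positivity
    have n1 : (j : ℝ) + r ≤ ‖z + j‖ := by
      refine le_trans ?_ (re_le_norm _)
      have := hball z hz
      simp; linarith
    have n2 : (j : ℝ) + r ≤ ‖a + j‖ := by
      refine le_trans ?_ (re_le_norm _)
      simp; linarith
    rw [inv_sub_inv ha0 hz0, norm_div, norm_mul, abs_of_pos hj, Real.rpow_two, mul_one_div,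
      show z + j - (a + j) = z - a by ring, pow_two]
    have : ‖z - a‖ ≤ r := mem_closedBall_iff_norm.mp hz
    gcongr
  · exact fun z hz => tendsto_digammaSeq (hr0.trans_le (hball z hz))

theorem iteratedDeriv_digammaSeq {a : ℂ} (ha : 0 < a.re) {m : ℕ} (hm : m ≠ 0) (n : ℕ) :
    iteratedDeriv m (digammaSeq n) a =
      (-1) ^ (m + 1) * m.factorial * ∑ j ∈ Finset.range (n + 1), 1 / (a + j) ^ (m + 1) := by
  have hd : ∀ j ∈ Finset.range (n + 1), ContDiffAt ℂ m (fun z : ℂ => (z + j)⁻¹) a := fun j _ =>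
    (contDiffAt_id.add contDiffAt_const).inv (add_natCast_ne_zero ha j)
  unfold digammaSeq
  rw [iteratedDeriv_const_sub (Nat.pos_of_ne_zero hm), iteratedDeriv_neg, iteratedDeriv_fun_sum hd]
  simp only [iteratedDeriv_inv_add]
  rw [← Finset.mul_sum]; ring

/-- The partial fraction expansion of the polygamma functions. -/
theorem hasSum_iteratedDeriv_digamma {a : ℂ} (ha : 0 < a.re) {m : ℕ} (hm : m ≠ 0) :
    HasSum (fun k : ℕ => (-1) ^ (m + 1) * m.factorial * (1 / (a + k) ^ (m + 1)))
      (iteratedDeriv m digamma a) := by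
  have hs : Summable fun k : ℕ => (-1) ^ (m + 1) * (m.factorial : ℂ) * (1 / (a + k) ^ (m + 1)) := by
    refine Summable.mul_left _ (Summable.of_norm_bounded
      ((Real.summable_one_div_nat_add_rpow a.re (m + 1)).mpr ?_) fun k => ?_)
    · have : (1 : ℝ) ≤ m := by exact_mod_cast Nat.pos_of_ne_zero hm
      linarith
    · have hk : 0 < (k : ℝ) + a.re := by positivity
      rw [norm_div, norm_one, norm_pow, abs_of_pos hk]
      have : (k : ℝ) + a.re ≤ ‖a + k‖ := by
        refine le_trans ?_ (re_le_norm _)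
        simp [add_comm]
      rw [show ((m : ℝ) + 1) = ((m + 1 : ℕ) : ℝ) by push_cast; rfl, Real.rpow_natCast]
      gcongr
  have h1 := (tendsto_iteratedDeriv_digammaSeq ha m).congr fun n =>
    (iteratedDeriv_digammaSeq ha hm n).trans (Finset.mul_sum _ _ _)
  -- The shift by one matches the n + 1 terms of `digammaSeq n`.
  have h2 := (hs.hasSum.tendsto_sum_nat).comp (tendsto_add_atTop_nat 1)
  rw [← tendsto_nhds_unique h2 h1]
  exact hs.hasSum

/-! ### Dividing an entire function by finitely many zeros -/

theorem Differentiable.analyticOrderAt_ne_top {f : ℂ → ℂ} (hf : Differentiable ℂ f) {w : ℂ}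
    (hw : f w ≠ 0) (a : ℂ) : analyticOrderAt f a ≠ ⊤ := by
  have hA : AnalyticOnNhd ℂ f Set.univ := hf.differentiableOn.analyticOnNhd isOpen_univ
  refine hA.analyticOrderAt_ne_top_of_isPreconnected isPreconnected_univ (Set.mem_univ w)
    (Set.mem_univ a) ?_
  rw [(hA w (Set.mem_univ w)).analyticOrderAt_eq_zero.mpr hw]
  exact ENat.zero_ne_top

theorem Differentiable.finite_zeros_closedBall {f : ℂ → ℂ} (hf : Differentiable ℂ f)
    (h0 : f 0 ≠ 0) (R : ℝ) : {a : ℂ | f a = 0 ∧ a ∈ closedBall 0 R}.Finite := by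
  have hA : AnalyticOnNhd ℂ f Set.univ := hf.differentiableOn.analyticOnNhd isOpen_univ
  by_contra hinf
  obtain ⟨x, -, hx⟩ := (show {a : ℂ | f a = 0 ∧ a ∈ closedBall 0 R}.Infinite from hinf)
    |>.exists_accPt_of_subset_isCompact (isCompact_closedBall 0 R) fun a ha => ha.2
  have hfr : ∃ᶠ z in 𝓝[≠] x, f z = 0 := by
    rw [accPt_iff_frequently_nhdsNE] at hx
    exact hx.mono fun z hz => hz.1
  exact h0 (hA.eqOn_zero_of_preconnected_of_frequently_eq_zero isPreconnected_univ
    (Set.mem_univ x) hfr (Set.mem_univ 0))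

/-- An entire function can be divided by the linear factors of one of its zeros. -/
theorem Differentiable.exists_eq_pow_mul {g : ℂ → ℂ} (hg : Differentiable ℂ g) {a : ℂ}
    (ha : analyticOrderAt g a ≠ ⊤) :
    ∃ h : ℂ → ℂ, Differentiable ℂ h ∧ h a ≠ 0 ∧
      ∀ z, g z = (z - a) ^ analyticOrderNatAt g a * h z := by
  obtain ⟨h0, hh0, hne, he⟩ := (hg.analyticAt a).analyticOrderAt_ne_top.mp ha
  set m := analyticOrderNatAt g a
  classical
  have hev : (fun z => if z = a then h0 a else g z / (z - a) ^ m) =ᶠ[𝓝 a] h0 := by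
    filter_upwards [he] with z hz
    split_ifs with h
    · rw [h]
    · rw [hz, smul_eq_mul, mul_div_cancel_left₀ _ (pow_ne_zero _ (sub_ne_zero.mpr h))]
  refine ⟨fun z => if z = a then h0 a else g z / (z - a) ^ m, fun z => ?_, by simpa using hne,
    fun z => ?_⟩
  · by_cases h : z = a
    · subst h
      exact hh0.differentiableAt.congr_of_eventuallyEq hev
    · have : (fun w => if w = a then h0 a else g w / (w - a) ^ m) =ᶠ[𝓝 z]
          fun w => g w / (w - a) ^ m := by
        filter_upwards [isOpen_ne.mem_nhds h] with w hw
        rw [if_neg hw]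
      refine DifferentiableAt.congr_of_eventuallyEq ?_ this
      exact (hg z).div ((differentiableAt_id.sub_const a).pow m)
        (pow_ne_zero _ (sub_ne_zero.mpr h))
  · by_cases h : z = a
    · subst h
      simpa using he.self_of_nhds
    · simp only [if_neg h]
      rw [mul_div_cancel₀ _ (pow_ne_zero _ (sub_ne_zero.mpr h))]

/-- Division of an entire function by the linear factors of finitely many zeros. -/
theorem Differentiable.exists_eq_mul_prod {f : ℂ → ℂ} (hf : Differentiable ℂ f) (h0 : f 0 ≠ 0)
    (S : Finset ℂ) (hS : ∀ a ∈ S, f a = 0) :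
    ∃ h : ℂ → ℂ, Differentiable ℂ h ∧ (∀ a ∈ S, h a ≠ 0) ∧
      ∀ z, f z = h z * ∏ a ∈ S, (1 - z / a) ^ analyticOrderNatAt f a := by
  classical
  induction S using Finset.induction_on with
  | empty => exact ⟨f, hf, by simp, by simp⟩
  | insert a S ha ih =>
    obtain ⟨h, hh, hne, he⟩ := ih fun b hb => hS b (Finset.mem_insert_of_mem hb)
    have ha0 : a ≠ 0 := by
      rintro rfl
      exact h0 (hS 0 (Finset.mem_insert_self _ _))
    have hh0 : h 0 ≠ 0 := fun h' => h0 (by rw [he 0, h', zero_mul])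
    have htop := hh.analyticOrderAt_ne_top hh0 a
    set P : ℂ → ℂ := fun z => ∏ b ∈ S, (1 - z / b) ^ analyticOrderNatAt f b with hP
    have hPd : Differentiable ℂ P := by
      rw [hP]
      fun_prop
    have hPa : P a ≠ 0 := by
      refine Finset.prod_ne_zero_iff.mpr fun b hb => pow_ne_zero _ ?_
      have hb0 : b ≠ 0 := by
        rintro rfl
        exact h0 (hS 0 (Finset.mem_insert_of_mem hb))
      rw [sub_ne_zero, ne_comm, Ne, div_eq_one_iff_eq hb0]
      rintro rfl
      exact ha hb
    have hPord : analyticOrderAt P a = 0 := (hPd.analyticAt a).analyticOrderAt_eq_zero.mpr hPa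
    -- The factors already removed do not vanish at a, so f and the current quotient have the same
    -- order there.
    have hord : analyticOrderNatAt f a = analyticOrderNatAt h a := by
      rw [show f = h * P from funext he, analyticOrderNatAt,
        analyticOrderAt_mul (hh.analyticAt a) (hPd.analyticAt a), hPord, add_zero,
        analyticOrderNatAt]
    obtain ⟨k, hk, hka, hke⟩ := hh.exists_eq_pow_mul htop
    rw [← hord] at hke
    refine ⟨fun z => (-a) ^ analyticOrderNatAt f a * k z, hk.const_mul _, fun b hb => ?_,
      fun z => ?_⟩
    · have hc : (-a) ^ analyticOrderNatAt f a ≠ 0 := pow_ne_zero _ (neg_ne_zero.mpr ha0)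
      rcases Finset.mem_insert.mp hb with rfl | hb
      · exact mul_ne_zero hc hka
      · exact mul_ne_zero hc fun h' => hne b hb (by rw [hke b, h', mul_zero])
    · rw [Finset.prod_insert ha, he z, hke z]
      have : z - a = -a * (1 - z / a) := by field_simp; ring
      rw [this, mul_pow]; ring

/-! ### Logarithmic derivatives and power sums over zeros -/

/-- The logarithmic derivative of a product with linear factors. -/
theorem iteratedDeriv_logDeriv_mul_prod {f h : ℂ → ℂ} (hh : Differentiable ℂ h) (h0 : f 0 ≠ 0)
    {S : Finset ℂ} {m : ℂ → ℕ} (hS : ∀ a ∈ S, a ≠ 0)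
    (he : ∀ z, f z = h z * ∏ a ∈ S, (1 - z / a) ^ m a) (n : ℕ) :
    iteratedDeriv n (logDeriv f) 0 =
      iteratedDeriv n (logDeriv h) 0 - n.factorial * ∑ a ∈ S, m a * (1 / a ^ (n + 1)) := by
  have hh0 : h 0 ≠ 0 := fun h' => h0 (by rw [he 0, h', zero_mul])
  have hcont : Continuous f := by
    rw [show f = _ from funext he]
    exact hh.continuous.mul (by fun_prop)
  have hev : logDeriv f =ᶠ[𝓝 0] fun z => logDeriv h z + ∑ a ∈ S, (m a : ℂ) * (z + -a)⁻¹ := by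
    filter_upwards [hcont.continuousAt.eventually_ne h0] with z hz
    have hz' := hz
    rw [he z] at hz'
    have hhz := left_ne_zero_of_mul hz'
    have hPz := right_ne_zero_of_mul hz'
    have hfac := Finset.prod_ne_zero_iff.mp hPz
    rw [show f = fun z => h z * ∏ a ∈ S, (1 - z / a) ^ m a from funext he,
      logDeriv_mul z hhz hPz (hh z) (by fun_prop),
      logDeriv_prod (f := fun a z => (1 - z / a) ^ m a) hfac (fun a _ => by fun_prop)]
    congr 1
    refine Finset.sum_congr rfl fun a ha => ?_
    have ha0 := hS a ha
    rw [logDeriv_fun_pow (by fun_prop)]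
    rcases Nat.eq_zero_or_pos (m a) with hm | hm
    · simp [hm]
    have h1 : 1 - z / a ≠ 0 := fun h' => hfac a ha (by rw [h', zero_pow hm.ne'])
    have h2 : a - z ≠ 0 := fun h' => h1 (by rw [← sub_eq_zero.mp h', div_self ha0, sub_self])
    have h3 : z + -a ≠ 0 := fun h' => h2 (by linear_combination -h')
    congr 1
    have hd : deriv (fun w : ℂ => 1 - w / a) z = -(1 / a) := by
      simp [deriv_div_const]
    rw [logDeriv_apply, hd, show 1 - z / a = (a - z) / a by field_simp]
    rw [show z + -a = -(a - z) by ring]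
    field_simp
  rw [hev.iteratedDeriv_eq n]
  have hL : AnalyticAt ℂ (logDeriv h) 0 := (hh.analyticAt 0).deriv.div (hh.analyticAt 0) hh0
  have hT : ∀ a ∈ S, ContDiffAt ℂ n (fun z => (m a : ℂ) * (z + -a)⁻¹) 0 := fun a ha =>
    contDiffAt_const.mul ((contDiffAt_id.add contDiffAt_const).inv (by simpa using hS a ha))
  rw [iteratedDeriv_fun_add hL.contDiffAt (ContDiffAt.sum hT), iteratedDeriv_fun_sum hT,
    sub_eq_add_neg, Finset.mul_sum, ← Finset.sum_neg_distrib]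
  congr 1
  refine Finset.sum_congr rfl fun a _ => ?_
  rw [iteratedDeriv_const_mul_field, iteratedDeriv_inv_add, zero_add, neg_pow a, pow_succ (-1 : ℂ)]
  have : ((-1 : ℂ) ^ n) * (-1) ^ n = 1 := by rw [← mul_pow]; simp
  rcases eq_or_ne ((-1 : ℂ) ^ n) 0 with h | h
  · simp [h] at this
  · field_simp

/-- Cauchy's estimate for the logarithm of a zero-free function bounded by `exp M · |h(0)|`. -/
theorem norm_iteratedDeriv_logDeriv_le {h : ℂ → ℂ} (hh : Differentiable ℂ h) {R M : ℝ}
    (hR : 0 < R) (hM : 0 < M) (hne : ∀ z ∈ ball 0 R, h z ≠ 0)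
    (hb : ∀ z ∈ ball 0 R, ‖h z‖ ≤ ‖h 0‖ * Real.exp M) (n : ℕ) :
    ‖iteratedDeriv n (logDeriv h) 0‖ ≤ (n + 1).factorial * (2 * M) / (R / 2) ^ (n + 1) := by
  have h00 : h 0 ≠ 0 := hne 0 (mem_ball_self hR)
  have hld : DifferentiableOn ℂ (logDeriv h) (ball 0 R) :=
    (hh.differentiableOn.deriv isOpen_ball).div hh.differentiableOn hne
  -- L is the branch of log(h / h(0)) vanishing at 0; the bound on h becomes Re L ≤ M.
  obtain ⟨L, hL0, hL⟩ := hld.isExactOn_ball.with_val_at 0 0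
  have hLd : DifferentiableOn ℂ L (ball 0 R) := fun z hz =>
    (hL z hz).differentiableAt.differentiableWithinAt
  have hexp : ∀ z ∈ ball (0 : ℂ) R, h z = h 0 * exp (L z) := by
    have hder : ∀ z ∈ ball (0 : ℂ) R, HasDerivAt (fun z => h z * exp (-L z)) 0 z := fun z hz => by
      refine ((hh z).hasDerivAt.mul (hL z hz).neg.cexp).congr_deriv ?_
      rw [logDeriv_apply]
      field_simp [hne z hz]
      ring
    intro z hz
    have := (convex_ball (0 : ℂ) R).is_const_of_fderivWithin_eq_zero (𝕜 := ℂ)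
      (f := fun z => h z * exp (-L z))
      (fun w hw => (hder w hw).differentiableAt.differentiableWithinAt)
      (fun w hw => by
        rw [fderivWithin_of_isOpen isOpen_ball hw]
        ext
        simp [(hder w hw).deriv]) hz (mem_ball_self hR)
    simp only [hL0, neg_zero, exp_zero, mul_one] at this
    rw [← this, mul_assoc, ← exp_add, neg_add_cancel, exp_zero, mul_one]
  have hre : Set.MapsTo L (ball 0 R) {z | z.re ≤ M} := fun z hz => by
    have h1 := hb z hz
    rw [hexp z hz, norm_mul, norm_exp] at h1
    exact Real.exp_le_exp.mp (le_of_mul_le_mul_left h1 (norm_pos_iff.mpr h00))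
  have hR2 : 0 < R / 2 := half_pos hR
  have hsub : closedBall (0 : ℂ) (R / 2) ⊆ ball 0 R := closedBall_subset_ball (half_lt_self hR)
  -- Borel–Carathéodory gives 2Mr/(R - r), which is 2M at r = R/2.
  have hC : ∀ z ∈ sphere (0 : ℂ) (R / 2), ‖L z‖ ≤ 2 * M := fun z hz => by
    have h1 := borelCaratheodory_zero hM hLd hre hR (hsub (sphere_subset_closedBall hz)) hL0
    rw [mem_sphere_zero_iff_norm.mp hz] at h1
    refine h1.trans (le_of_eq ?_)
    field_simp
    ring
  have hcl : DiffContOnCl ℂ L (ball 0 (R / 2)) :=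
    (hLd.mono (closure_ball_subset_closedBall.trans hsub)).diffContOnCl
  have h2 := norm_iteratedDeriv_le_of_forall_mem_sphere_norm_le (n + 1) hR2 hcl hC
  rw [iteratedDeriv_succ'] at h2
  have hev : deriv L =ᶠ[𝓝 0] logDeriv h := by
    filter_upwards [ball_mem_nhds (0 : ℂ) hR] with z hz using (hL z hz).deriv
  rwa [hev.iteratedDeriv_eq n] at h2

/-- The zeros of `f`, each repeated according to its multiplicity. -/
abbrev ZerosWithMult (f : ℂ → ℂ) : Type :=
  Σ α : {α : ℂ // f α = 0}, Fin (analyticOrderNatAt f (α : ℂ))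

/-- Bounds for the quotient of an entire function by its zeros in a disc. -/
theorem norm_mul_two_pow_le_of_eq_mul_prod {f h : ℂ → ℂ} (hh : Differentiable ℂ h)
    {S : Finset ℂ} {m : ℂ → ℕ} {R B : ℝ} (hR : 0 < R) (hS : ∀ a ∈ S, a ≠ 0 ∧ ‖a‖ ≤ R)
    (he : ∀ z, f z = h z * ∏ a ∈ S, (1 - z / a) ^ m a)
    (hB : ∀ z ∈ sphere (0 : ℂ) (3 * R), ‖f z‖ ≤ B) {z : ℂ} (hz : ‖z‖ ≤ 3 * R) :
    ‖h z‖ * 2 ^ (∑ a ∈ S, m a) ≤ B := by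
  have h2 : (0 : ℝ) < 2 ^ (∑ a ∈ S, m a) := by positivity
  rw [← le_div_iff₀ h2]
  have hR3 : 3 * R ≠ 0 := by positivity
  refine norm_le_of_forall_mem_frontier_norm_le (U := ball (0 : ℂ) (3 * R)) isBounded_ball
    hh.diffContOnCl (fun w hw => ?_) (by rwa [closure_ball _ hR3, mem_closedBall_zero_iff])
  rw [frontier_ball _ hR3] at hw
  rw [le_div_iff₀ h2]
  refine le_trans ?_ (hB w hw)
  rw [he w, norm_mul, norm_prod, ← Finset.prod_pow_eq_pow_sum]
  refine mul_le_mul_of_nonneg_left (Finset.prod_le_prod (fun a _ => by positivity) fun a ha => ?_)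
    (norm_nonneg _)
  rw [norm_pow]
  refine pow_le_pow_left₀ (by norm_num) ?_ _
  obtain ⟨ha0, haR⟩ := hS a ha
  have hap : 0 < ‖a‖ := norm_pos_iff.mpr ha0
  -- Radius 3R is chosen so that |w/a| ≥ 3, hence |1 - w/a| ≥ 2.
  have h3 : (3 : ℝ) ≤ ‖w / a‖ := by
    rw [norm_div, mem_sphere_zero_iff_norm.mp hw, le_div_iff₀ hap]
    gcongr
  have := norm_sub_norm_le (w / a) 1
  rw [norm_one, norm_sub_rev] at this
  linarith

/-- A family of positive numbers whose counting function has order `ρ` has convergence exponent at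
most `ρ`. -/
theorem summable_one_div_pow_of_card_le {ι : Type*} {r : ι → ℝ} {c K ρ : ℝ} {n : ℕ} (hc : 0 < c)
    (hr : ∀ i, c ≤ r i) (hn : ρ < n)
    (hcard : ∀ R : ℝ, 0 < R → ∀ u : Finset ι, (∀ i ∈ u, r i ≤ R) → (u.card : ℝ) ≤ K * R ^ ρ) :
    Summable fun i => 1 / r i ^ n := by
  classical
  -- Dyadic shells: shell k contributes at most a constant times 2^{k(ρ - n)}, a convergent
  -- geometric series.
  have hex : ∀ i, ∃ j : ℕ, c * 2 ^ j ≤ r i ∧ r i < c * 2 ^ (j + 1) := fun i => by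
    obtain ⟨j, h1, h2⟩ := exists_nat_pow_near (x := r i / c) (y := 2)
      ((one_le_div hc).mpr (hr i)) one_lt_two
    exact ⟨j, by rwa [le_div_iff₀' hc] at h1, by rwa [div_lt_iff₀' hc] at h2⟩
  choose j hj1 hj2 using hex
  set q : ℝ := 2 ^ (ρ - n) with hq
  have hq0 : 0 < q := by positivity
  have hq1 : q < 1 := Real.rpow_lt_one_of_one_lt_of_neg one_lt_two (by linarith)
  set A : ℝ := |K| * (c * 2) ^ ρ / c ^ n with hA
  have hgeo : Summable fun k : ℕ => A * q ^ k := (summable_geometric_of_lt_one hq0.le hq1).mul_left A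
  refine summable_of_sum_le (c := ∑' k : ℕ, A * q ^ k)
    (fun i => by have := hc.trans_le (hr i); positivity) fun u => ?_
  rw [← Finset.sum_fiberwise_of_maps_to (t := u.image j) (g := j)
    fun i hi => Finset.mem_image_of_mem _ hi]
  refine le_trans (Finset.sum_le_sum fun k _ => ?_)
    (hgeo.sum_le_tsum (u.image j) fun k _ => by positivity)
  have hterm : ∀ i ∈ u.filter (fun i => j i = k), 1 / r i ^ n ≤ 1 / (c * 2 ^ k) ^ n := by
    intro i hi
    have := hj1 i
    rw [(Finset.mem_filter.mp hi).2] at this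
    gcongr
  have hcd := hcard (c * 2 ^ (k + 1)) (by positivity) (u.filter (fun i => j i = k)) fun i hi => by
    have := hj2 i
    rw [(Finset.mem_filter.mp hi).2] at this
    exact this.le
  refine (Finset.sum_le_card_nsmul _ _ _ hterm).trans ?_
  rw [nsmul_eq_mul]
  calc _ ≤ (|K| * (c * 2 ^ (k + 1)) ^ ρ) * (1 / (c * 2 ^ k) ^ n) := by
        gcongr
        exact hcd.trans (by gcongr; exact le_abs_self K)
    _ = A * q ^ k := by
        rw [hA, hq, pow_succ, show c * ((2 : ℝ) ^ k * 2) = (c * 2) * 2 ^ k by ring,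
          Real.mul_rpow (by positivity) (by positivity), mul_pow, Real.rpow_sub two_pos, div_pow,
          Real.rpow_natCast, ← pow_mul, ← pow_mul, ← Real.rpow_natCast 2 k, ← Real.rpow_mul two_pos.le,
          ← Real.rpow_natCast (2 ^ ρ : ℝ) k, ← Real.rpow_mul two_pos.le, mul_comm (k : ℝ) ρ,
          mul_comm k n]
        field_simp

section Order

variable {f : ℂ → ℂ} {C ρ : ℝ}

/-- The zeros of `f` in the closed disc of radius `R`. -/
noncomputable def zerosInDisc (hf : Differentiable ℂ f) (h0 : f 0 ≠ 0) (R : ℝ) : Finset ℂ :=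
  (hf.finite_zeros_closedBall h0 R).toFinset

theorem mem_zerosInDisc (hf : Differentiable ℂ f) (h0 : f 0 ≠ 0) {R : ℝ} {a : ℂ} :
    a ∈ zerosInDisc hf h0 R ↔ f a = 0 ∧ ‖a‖ ≤ R := by
  simp [zerosInDisc]

/-- The zeros of `f` in the closed disc of radius `R`, repeated according to multiplicity. -/
noncomputable def zerosWithMultInDisc (hf : Differentiable ℂ f) (h0 : f 0 ≠ 0) (R : ℝ) :
    Finset (ZerosWithMult f) :=
  ((zerosInDisc hf h0 R).subtype (fun a => f a = 0)).sigma fun _ => Finset.univ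

theorem mem_zerosWithMultInDisc (hf : Differentiable ℂ f) (h0 : f 0 ≠ 0) {R : ℝ}
    {z : ZerosWithMult f} : z ∈ zerosWithMultInDisc hf h0 R ↔ ‖(z.1 : ℂ)‖ ≤ R := by
  simp [zerosWithMultInDisc, mem_zerosInDisc, z.1.2]

theorem sum_zerosWithMultInDisc {E : Type*} [AddCommMonoid E] (hf : Differentiable ℂ f)
    (h0 : f 0 ≠ 0) (R : ℝ) (φ : ℂ → E) :
    ∑ z ∈ zerosWithMultInDisc hf h0 R, φ z.1 =
      ∑ a ∈ zerosInDisc hf h0 R, analyticOrderNatAt f a • φ a := by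
  rw [zerosWithMultInDisc, Finset.sum_sigma]
  simp only [Finset.sum_const, Finset.card_univ, Fintype.card_fin]
  rw [Finset.sum_subtype_of_mem (fun a => analyticOrderNatAt f a • φ a)
    fun a ha => ((mem_zerosInDisc hf h0).mp ha).1]

/-- The approximate partial fraction expansion of the logarithmic derivative, and the bound for the
number of zeros in a disc. -/
theorem logDeriv_estimate (hf : Differentiable ℂ f) (h0 : f 0 ≠ 0) {R M : ℝ} (hR : 0 < R)
    (hM : 0 < M) (hb : ∀ z ∈ sphere (0 : ℂ) (3 * R), ‖f z‖ ≤ ‖f 0‖ * Real.exp M) (n : ℕ) :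
    (zerosWithMultInDisc hf h0 R).card * Real.log 2 ≤ M ∧
    ‖iteratedDeriv n (logDeriv f) 0 +
        n.factorial * ∑ z ∈ zerosWithMultInDisc hf h0 R, 1 / (z.1 : ℂ) ^ (n + 1)‖ ≤
      (n + 1).factorial * (2 * M) / (R / 2) ^ (n + 1) := by
  have hS : ∀ a ∈ zerosInDisc hf h0 R, a ≠ 0 ∧ ‖a‖ ≤ R := fun a ha => by
    obtain ⟨h1, h2⟩ := (mem_zerosInDisc hf h0).mp ha
    exact ⟨by rintro rfl; exact h0 h1, h2⟩
  obtain ⟨h, hh, hne, he⟩ := hf.exists_eq_mul_prod h0 (zerosInDisc hf h0 R)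
    fun a ha => ((mem_zerosInDisc hf h0).mp ha).1
  have hh0 : f 0 = h 0 := by simpa using he 0
  have hf0 : 0 < ‖f 0‖ := norm_pos_iff.mpr h0
  have key := fun {z : ℂ} (hz : ‖z‖ ≤ 3 * R) =>
    norm_mul_two_pow_le_of_eq_mul_prod hh hR hS he hb hz
  constructor
  -- At z = 0, where h(0) = f(0), the bound reads |f(0)| · 2^N ≤ |f(0)| e^M, with N the number of
  -- zeros.
  · have h1 := key (z := 0) (by simpa using hR.le)
    have hcard : (zerosWithMultInDisc hf h0 R).card =
        ∑ a ∈ zerosInDisc hf h0 R, analyticOrderNatAt f a := by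
      have := sum_zerosWithMultInDisc hf h0 R (fun _ => (1 : ℕ))
      simpa using this
    rw [← hh0, ← hcard] at h1
    have h2 := le_of_mul_le_mul_left h1 hf0
    rw [← Real.log_pow, ← Real.log_exp M]
    exact Real.log_le_log (by positivity) h2
  · have h1 := iteratedDeriv_logDeriv_mul_prod hh h0 (fun a ha => (hS a ha).1) he n
    have h2 : ∑ z ∈ zerosWithMultInDisc hf h0 R, 1 / (z.1 : ℂ) ^ (n + 1) =
        ∑ a ∈ zerosInDisc hf h0 R, (analyticOrderNatAt f a : ℂ) * (1 / a ^ (n + 1)) := by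
      rw [sum_zerosWithMultInDisc hf h0 R (fun a : ℂ => 1 / a ^ (n + 1))]
      simp only [nsmul_eq_mul]
    rw [h2, h1, sub_add_cancel]
    refine norm_iteratedDeriv_logDeriv_le hh hR hM (fun z hz hz0 => ?_) (fun z hz => ?_) n
    · have hz' := mem_ball_zero_iff.mp hz
      have hfz : f z = 0 := by rw [he z, hz0, zero_mul]
      exact hne z ((mem_zerosInDisc hf h0).mpr ⟨hfz, hz'.le⟩) hz0
    · have hz' := mem_ball_zero_iff.mp hz
      rw [← hh0]
      refine le_trans ?_ (key (z := z) (by linarith))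
      exact le_mul_of_one_le_right (norm_nonneg _) (one_le_pow₀ one_le_two)

/-- An entire function of order at most `ρ` is bounded by the exponential of a multiple of `R ^ ρ`
on circles of radius `3R`. -/
theorem exists_norm_le_mul_exp (h0 : f 0 ≠ 0) (hρ : 0 < ρ)
    (hgrowth : ∀ z, ‖f z‖ ≤ Real.exp (C * (1 + ‖z‖) ^ ρ)) {c : ℝ} (hc : 0 < c) :
    ∃ K > 0, ∀ R, c ≤ R → ∀ z ∈ sphere (0 : ℂ) (3 * R),
      ‖f z‖ ≤ ‖f 0‖ * Real.exp (K * R ^ ρ) := by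
  have hf0 : 0 < ‖f 0‖ := norm_pos_iff.mpr h0
  have hcρ : 0 < c ^ ρ := Real.rpow_pos_of_pos hc ρ
  -- The first term uses 1 + 3R ≤ (1/c + 3)R, the second absorbs log |f(0)|, and the 1 makes the
  -- constant positive.
  refine ⟨|C| * (1 / c + 3) ^ ρ + |Real.log ‖f 0‖| / c ^ ρ + 1, by positivity, fun R hR z hz => ?_⟩
  have hR0 : 0 < R := hc.trans_le hR
  rw [mem_sphere_zero_iff_norm] at hz
  nth_rw 1 [← Real.exp_log hf0]
  rw [← Real.exp_add]
  refine (hgrowth z).trans (Real.exp_le_exp.mpr ?_)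
  rw [hz]
  have h1 : (1 + 3 * R) ^ ρ ≤ (1 / c + 3) ^ ρ * R ^ ρ := by
    rw [← Real.mul_rpow (by positivity) hR0.le]
    refine Real.rpow_le_rpow (by positivity) ?_ hρ.le
    have : 1 ≤ 1 / c * R := by rw [one_div_mul_eq_div, le_div_iff₀ hc]; linarith
    linarith
  have h2 : C * (1 + 3 * R) ^ ρ ≤ |C| * ((1 / c + 3) ^ ρ * R ^ ρ) :=
    mul_le_mul (le_abs_self C) h1 (by positivity) (abs_nonneg C)
  have h3 : |Real.log ‖f 0‖| ≤ |Real.log ‖f 0‖| / c ^ ρ * R ^ ρ := by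
    rw [div_mul_eq_mul_div, le_div_iff₀ hcρ]
    gcongr
  have h4 : 0 < R ^ ρ := Real.rpow_pos_of_pos hR0 ρ
  have h5 := neg_abs_le (Real.log ‖f 0‖)
  nlinarith

/-- The zeros of an entire function of order at most `ρ` have convergence exponent at most `ρ`. -/
theorem summable_one_div_norm_zeros_pow (hf : Differentiable ℂ f) (h0 : f 0 ≠ 0) (hρ : 0 < ρ)
    (hgrowth : ∀ z, ‖f z‖ ≤ Real.exp (C * (1 + ‖z‖) ^ ρ)) {n : ℕ} (hn : ρ < n) :
    Summable fun z : ZerosWithMult f => 1 / ‖(z.1 : ℂ)‖ ^ n := by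
  obtain ⟨c, hc, hcz⟩ : ∃ c > 0, ∀ z : ZerosWithMult f, c ≤ ‖(z.1 : ℂ)‖ := by
    obtain ⟨c, hc, hb⟩ := Metric.eventually_nhds_iff.mp
      ((hf.continuous.continuousAt (x := 0)).eventually_ne h0)
    refine ⟨c, hc, fun z => ?_⟩
    by_contra h
    exact hb (by simpa using not_le.mp h) z.1.2
  obtain ⟨K, hK, hb⟩ := exists_norm_le_mul_exp h0 hρ hgrowth hc
  refine summable_one_div_pow_of_card_le (K := K / Real.log 2) hc hcz hn fun R hR u hu => ?_
  have hl := Real.log_pos one_lt_two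
  -- The growth bound is available only for R ≥ c; a smaller disc contains no zeros.
  rcases u.eq_empty_or_nonempty with rfl | ⟨i, hi⟩
  · simp only [Finset.card_empty, Nat.cast_zero]; positivity
  have hcR : c ≤ R := (hcz i).trans (hu i hi)
  have h1 := (logDeriv_estimate hf h0 hR (by positivity) (hb R hcR) 0).1
  rw [div_mul_eq_mul_div, le_div_iff₀ hl]
  refine le_trans ?_ h1
  gcongr
  exact fun z hz => (mem_zerosWithMultInDisc hf h0).mpr (hu z hz)

/-- The Taylor coefficients of the logarithmic derivative of an entire function of finite order are
power sums over its zeros. -/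
theorem hasSum_iteratedDeriv_logDeriv (hf : Differentiable ℂ f) (h0 : f 0 ≠ 0) (hρ : 0 < ρ)
    (hgrowth : ∀ z, ‖f z‖ ≤ Real.exp (C * (1 + ‖z‖) ^ ρ)) {n : ℕ} (hn : ρ < (n + 1 : ℕ)) :
    HasSum (fun z : ZerosWithMult f => 1 / (z.1 : ℂ) ^ (n + 1))
      (-(iteratedDeriv n (logDeriv f) 0 / n.factorial)) := by
  have hs : Summable fun z : ZerosWithMult f => 1 / (z.1 : ℂ) ^ (n + 1) := by
    refine Summable.of_norm ?_
    simpa using summable_one_div_norm_zeros_pow hf h0 hρ hgrowth hn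
  obtain ⟨K, hK, hb⟩ := exists_norm_le_mul_exp h0 hρ hgrowth one_pos
  have hmono : Monotone fun k : ℕ => zerosWithMultInDisc hf h0 (k : ℝ) := fun k l hkl z hz => by
    rw [mem_zerosWithMultInDisc] at hz ⊢
    exact hz.trans (Nat.cast_le.mpr hkl)
  have hlim1 := hs.hasSum.comp (tendsto_atTop_finset_of_monotone hmono fun z => by
    obtain ⟨k, hk⟩ := exists_nat_ge ‖(z.1 : ℂ)‖
    exact ⟨k, (mem_zerosWithMultInDisc hf h0).mpr hk⟩)
  have hfac : (n.factorial : ℂ) ≠ 0 := Nat.cast_ne_zero.mpr n.factorial_ne_zero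
  have hlim2 : Tendsto (fun k : ℕ => iteratedDeriv n (logDeriv f) 0 +
      n.factorial * ∑ z ∈ zerosWithMultInDisc hf h0 (k : ℝ), 1 / (z.1 : ℂ) ^ (n + 1)) atTop
      (𝓝 0) := by
    -- With M = K k^ρ, the estimate on the disc of radius k is a constant times k^{ρ - (n+1)}.
    have hp : Tendsto (fun k : ℕ => (n + 1).factorial * 2 * K * 2 ^ (n + 1) *
        (k : ℝ) ^ (-((n + 1 : ℕ) - ρ))) atTop (𝓝 0) := by
      have := (tendsto_rpow_neg_atTop (sub_pos.mpr hn)).comp tendsto_natCast_atTop_atTop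
      simpa using this.const_mul ((n + 1).factorial * 2 * K * 2 ^ (n + 1) : ℝ)
    refine squeeze_zero_norm' ?_ hp
    filter_upwards [eventually_ge_atTop 1] with k hk
    have hk1 : (1 : ℝ) ≤ k := by exact_mod_cast hk
    have hk0 : (0 : ℝ) < k := by linarith
    refine (logDeriv_estimate hf h0 hk0 (by positivity) (hb k hk1) n).2.trans (le_of_eq ?_)
    rw [neg_sub, Real.rpow_sub hk0, Real.rpow_natCast, div_pow]
    field_simp
  have h3 := tendsto_nhds_unique hlim2 ((hlim1.const_mul (n.factorial : ℂ)).const_add _)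
  have h4 : ∑' z : ZerosWithMult f, 1 / (z.1 : ℂ) ^ (n + 1) =
      -(iteratedDeriv n (logDeriv f) 0 / n.factorial) := by
    field_simp
    simp only [one_div] at h3 ⊢
    linear_combination -h3
  exact h4 ▸ hs.hasSum

end Order

/-! ### Continuation of ζ to Re s > 0, and the real zeros of ξ -/

/-- The integral `∫₁^∞ {t} t^{-s-1} dt`. -/
noncomputable def fractIntegral (s : ℂ) : ℂ :=
  ∫ t in Set.Ioi (1 : ℝ), ((Int.fract t : ℝ) : ℂ) * (t : ℂ) ^ (-(s + 1))

theorem norm_fract_mul_cpow_le {s : ℂ} {t : ℝ} (ht : 1 < t) :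
    ‖((Int.fract t : ℝ) : ℂ) * (t : ℂ) ^ (-(s + 1))‖ ≤ t ^ (-(s.re + 1)) := by
  rw [norm_mul, norm_cpow_eq_rpow_re_of_pos (by linarith), Complex.norm_real, Real.norm_eq_abs,
    abs_of_nonneg (Int.fract_nonneg t)]
  simp only [neg_re, add_re, one_re]
  exact mul_le_of_le_one_left (Real.rpow_nonneg (by linarith) _) (Int.fract_lt_one t).le

theorem aestronglyMeasurable_fract_mul_cpow (s : ℂ) :
    AEStronglyMeasurable (fun t : ℝ => ((Int.fract t : ℝ) : ℂ) * (t : ℂ) ^ (-(s + 1)))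
      (volume.restrict (Set.Ioi 1)) := by
  refine AEStronglyMeasurable.mul ?_ ?_
  · exact (measurable_ofReal.comp measurable_fract).aestronglyMeasurable
  · refine ContinuousOn.aestronglyMeasurable (fun t ht => ?_) measurableSet_Ioi
    exact (continuousAt_ofReal_cpow_const t _
      (Or.inr (zero_lt_one.trans ht).ne')).continuousWithinAt

theorem integrableOn_fract_mul_cpow {s : ℂ} (hs : 0 < s.re) :
    IntegrableOn (fun t : ℝ => ((Int.fract t : ℝ) : ℂ) * (t : ℂ) ^ (-(s + 1))) (Set.Ioi 1) := by
  refine Integrable.mono' (integrableOn_Ioi_rpow_of_lt (a := -(s.re + 1)) (by linarith) one_pos)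
    (aestronglyMeasurable_fract_mul_cpow s) ?_
  filter_upwards [ae_restrict_mem measurableSet_Ioi] with t ht using norm_fract_mul_cpow_le ht

theorem norm_fractIntegral_le {s : ℂ} (hs : 0 < s.re) : ‖fractIntegral s‖ ≤ 1 / s.re := by
  have h := norm_integral_le_of_norm_le (μ := volume.restrict (Set.Ioi (1 : ℝ)))
    (integrableOn_Ioi_rpow_of_lt (a := -(s.re + 1)) (by linarith) one_pos)
    (f := fun t : ℝ => ((Int.fract t : ℝ) : ℂ) * (t : ℂ) ^ (-(s + 1)))
    (by filter_upwards [ae_restrict_mem measurableSet_Ioi] with t ht using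
      norm_fract_mul_cpow_le ht)
  rw [integral_Ioi_rpow_of_lt (by linarith) one_pos, Real.one_rpow] at h
  refine h.trans (le_of_eq ?_)
  rw [show -(s.re + 1) + 1 = -s.re by ring, neg_div_neg_eq]

theorem fractIntegral_eq_mellin (s : ℂ) :
    fractIntegral s = mellin (Set.indicator (Set.Ioi 1) fun t : ℝ => ((Int.fract t : ℝ) : ℂ)) (-s) := by
  have : ∀ t : ℝ, (t : ℂ) ^ (-s - 1) •
      Set.indicator (Set.Ioi 1) (fun t : ℝ => ((Int.fract t : ℝ) : ℂ)) t =
      Set.indicator (Set.Ioi 1) (fun t : ℝ => ((Int.fract t : ℝ) : ℂ) * (t : ℂ) ^ (-(s + 1))) t := by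
    intro t
    by_cases ht : t ∈ Set.Ioi (1 : ℝ)
    · rw [Set.indicator_of_mem ht, Set.indicator_of_mem ht, smul_eq_mul, mul_comm]
      congr 2; ring
    · rw [Set.indicator_of_notMem ht, Set.indicator_of_notMem ht, smul_zero]
  simp only [mellin, this]
  rw [setIntegral_indicator measurableSet_Ioi, Set.inter_eq_right.mpr
    (Set.Ioi_subset_Ioi zero_le_one), fractIntegral]

/-- As a Mellin transform at -s, the integrand is bounded at infinity and vanishes on (0, 1), so the
transform is holomorphic for Re s > 0. -/
theorem differentiableAt_fractIntegral {s : ℂ} (hs : 0 < s.re) :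
    DifferentiableAt ℂ fractIntegral s := by
  set g : ℝ → ℂ := Set.indicator (Set.Ioi 1) fun t : ℝ => ((Int.fract t : ℝ) : ℂ) with hg
  have hle : ∀ t, ‖g t‖ ≤ 1 := fun t => by
    refine (norm_indicator_le_norm_self _ _).trans ?_
    rw [Complex.norm_real, Real.norm_eq_abs, abs_of_nonneg (Int.fract_nonneg t)]
    exact (Int.fract_lt_one t).le
  have hmeas : AEStronglyMeasurable g volume :=
    ((measurable_ofReal.comp measurable_fract).indicator measurableSet_Ioi).aestronglyMeasurable
  have hloc : LocallyIntegrableOn g (Set.Ioi 0) := by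
    refine LocallyIntegrable.locallyIntegrableOn ?_ _
    refine (locallyIntegrable_const (1 : ℝ)).mono hmeas (Eventually.of_forall fun t => ?_)
    simpa using hle t
  have hd : DifferentiableAt ℂ (mellin g) (-s) := by
    refine mellin_differentiableAt_of_isBigO_rpow (a := 0) (b := (-s).re - 1) hloc ?_ ?_ ?_ ?_
    · refine Asymptotics.IsBigO.of_bound 1 (Eventually.of_forall fun t => ?_)
      simpa using hle t
    · simpa using hs
    · refine Asymptotics.IsBigO.of_bound 1 ?_
      filter_upwards [Ioo_mem_nhdsGT one_pos] with t ht
      rw [hg, Set.indicator_of_notMem (by simpa using ht.2.le)]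
      simp only [norm_zero]
      positivity
    · linarith
  rw [show fractIntegral = fun s => mellin g (-s) from funext fractIntegral_eq_mellin]
  exact DifferentiableAt.comp (g := mellin g) s hd differentiableAt_id.neg

/-- Abel summation gives s ∫₁^∞ ⌊t⌋ t^{-s-1} dt; then split ⌊t⌋ = t - {t}. -/
theorem riemannZeta_eq_fractIntegral {s : ℂ} (hs : 1 < s.re) :
    riemannZeta s = s / (s - 1) - s * fractIntegral s := by
  have hO : (fun n : ℕ => ∑ k ∈ Finset.Icc 1 n, ‖(1 : ℕ → ℂ) k‖) =O[atTop]
      fun n => (n : ℝ) ^ (1 : ℝ) := by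
    refine Asymptotics.IsBigO.of_bound 1 (Eventually.of_forall fun n => ?_)
    simp
  have h := LSeries_eq_mul_integral' (1 : ℕ → ℂ) zero_le_one hs hO
  rw [LSeries_one_eq_riemannZeta hs] at h
  have hs1 : s - 1 ≠ 0 := fun h' => by
    rw [sub_eq_zero.mp h'] at hs
    simp at hs
  have hint : ∫ t in Set.Ioi (1 : ℝ), (∑ k ∈ Finset.Icc 1 ⌊t⌋₊, (1 : ℕ → ℂ) k) *
      (t : ℂ) ^ (-(s + 1)) = ∫ t in Set.Ioi (1 : ℝ), ((t : ℂ) ^ (-s) -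
        ((Int.fract t : ℝ) : ℂ) * (t : ℂ) ^ (-(s + 1))) := by
    refine setIntegral_congr_fun measurableSet_Ioi fun t ht => ?_
    have ht0 : (0 : ℝ) < t := zero_lt_one.trans ht
    have h1 : (∑ k ∈ Finset.Icc 1 ⌊t⌋₊, (1 : ℕ → ℂ) k) = (t : ℂ) - ((Int.fract t : ℝ) : ℂ) := by
      simp only [Pi.one_apply, Finset.sum_const, Nat.card_Icc, add_tsub_cancel_right, nsmul_eq_mul,
        mul_one]
      rw [← ofReal_sub, Int.self_sub_fract, ofReal_intCast, ← Int.natCast_floor_eq_floor ht0.le,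
        Int.cast_natCast]
    have h2 : (t : ℂ) ^ (-s) = t * (t : ℂ) ^ (-(s + 1)) := by
      rw [show -s = 1 + -(s + 1) by ring, cpow_add _ _ (ofReal_ne_zero.mpr ht0.ne'), cpow_one]
    simp only [h1, h2]
    ring
  rw [hint, integral_sub (integrableOn_Ioi_cpow_of_lt (by simpa using hs) one_pos)
    (integrableOn_fract_mul_cpow (by linarith)),
    integral_Ioi_cpow_of_lt (by simpa using hs) one_pos] at h
  rw [h, fractIntegral, mul_sub, ofReal_one, one_cpow]
  congr 1
  rw [show -s + 1 = -(s - 1) by ring, neg_div_neg_eq, mul_one_div]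

theorem differentiableAt_Gammaℝ {s : ℂ} (hs : 0 < s.re) : DifferentiableAt ℂ Gammaℝ s := by
  have h := (differentiable_Gammaℝ_inv s).inv (inv_ne_zero (Gammaℝ_ne_zero_of_re_pos hs))
  rwa [show (fun s => (Gammaℝ s)⁻¹)⁻¹ = Gammaℝ from funext fun s => inv_inv _] at h

theorem riemannXi_eq_Gammaℝ_mul {s : ℂ} (h1 : s ≠ 1) (hs : 0 < s.re) :
    riemannXi s = s * (s - 1) / 2 * Gammaℝ s * riemannZeta s := by
  rw [riemannXi_eq s h1 fun k hk => ?_, Gammaℝ_def]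
  · ring
  · have := congrArg Complex.re hk
    simp at this
    have h2 : (0 : ℝ) ≤ k := k.cast_nonneg
    linarith

/-- Multiplying by s - 1 removes the pole of ζ, so both sides are holomorphic for Re s > 0. They
agree near 2, and the identity theorem does the rest. -/
theorem riemannXi_eq_fractIntegral {s : ℂ} (hs : 0 < s.re) :
    riemannXi s = s / 2 * Gammaℝ s * (s - s * (s - 1) * fractIntegral s) := by
  have ho : IsOpen {z : ℂ | 0 < z.re} := isOpen_lt continuous_const continuous_re
  have hA : AnalyticOnNhd ℂ riemannXi {z | 0 < z.re} :=
    differentiable_riemannXi.differentiableOn.analyticOnNhd ho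
  have hB : AnalyticOnNhd ℂ (fun s => s / 2 * Gammaℝ s * (s - s * (s - 1) * fractIntegral s))
      {z | 0 < z.re} := by
    refine DifferentiableOn.analyticOnNhd (fun z hz => DifferentiableAt.differentiableWithinAt ?_) ho
    have := differentiableAt_Gammaℝ hz
    have := differentiableAt_fractIntegral hz
    fun_prop
  refine hA.eqOn_of_preconnected_of_eventuallyEq hB (convex_halfSpace_re_gt 0).isPreconnected
    (show (2 : ℂ) ∈ {z : ℂ | 0 < z.re} by simp) ?_ hs
  filter_upwards [(isOpen_lt continuous_const continuous_re).mem_nhds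
    (show (2 : ℂ) ∈ {z : ℂ | 1 < z.re} by simp)] with z hz
  have hz1 : z ≠ 1 := by rintro rfl; simp at hz
  rw [riemannXi_eq_Gammaℝ_mul hz1 (one_pos.trans hz), riemannZeta_eq_fractIntegral hz]
  have := sub_ne_zero.mpr hz1
  field_simp

theorem riemannXi_one_sub (s : ℂ) : riemannXi (1 - s) = riemannXi s := by
  rw [riemannXi, riemannXi, completedRiemannZeta₀_one_sub]
  ring

/-- `ξ` has no real zeros. -/
theorem riemannXi_ofReal_ne_zero (x : ℝ) : riemannXi x ≠ 0 := by
  have key : ∀ x : ℝ, 0 < x → riemannXi x ≠ 0 := by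
    intro x hx
    have hre : 0 < (x : ℂ).re := by simpa using hx
    have hG := Gammaℝ_ne_zero_of_re_pos hre
    have hx0 : (x : ℂ) ≠ 0 := ofReal_ne_zero.mpr hx.ne'
    rcases lt_or_ge 1 x with h1 | h1
    · have hx1 : (x : ℂ) ≠ 1 := by exact_mod_cast h1.ne'
      rw [riemannXi_eq_Gammaℝ_mul hx1 hre]
      have hz := riemannZeta_ne_zero_of_one_le_re (s := x) (by simpa using h1.le)
      exact mul_ne_zero (mul_ne_zero (div_ne_zero (mul_ne_zero hx0 (sub_ne_zero.mpr hx1))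
        two_ne_zero) hG) hz
    -- For 0 < x ≤ 1 the bracket is x + x(1 - x)j with j ≥ 0, hence positive.
    · set j : ℝ := ∫ t in Set.Ioi (1 : ℝ), Int.fract t * t ^ (-(x + 1)) with hj
      have hj0 : 0 ≤ j := setIntegral_nonneg measurableSet_Ioi fun t ht =>
        mul_nonneg (Int.fract_nonneg t) (Real.rpow_nonneg (zero_le_one.trans (le_of_lt ht)) _)
      have hJ : fractIntegral x = j := by
        rw [fractIntegral, hj, ← integral_complex_ofReal]
        refine setIntegral_congr_fun measurableSet_Ioi fun t ht => ?_
        have ht0 : (0 : ℝ) ≤ t := zero_le_one.trans (le_of_lt ht)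
        simp only [ofReal_mul, ofReal_cpow ht0]
        push_cast
        rfl
      rw [riemannXi_eq_fractIntegral hre, hJ]
      refine mul_ne_zero (mul_ne_zero (div_ne_zero hx0 two_ne_zero) hG) ?_
      have : (x - x * (x - 1) * j : ℝ) ≠ 0 := by
        have : 0 ≤ x * (1 - x) * j := by
          have : 0 ≤ 1 - x := by linarith
          positivity
        nlinarith
      exact_mod_cast this
  rcases lt_or_ge 0 x with h | h
  · exact key x h
  · rw [← riemannXi_one_sub]
    have := key (1 - x) (by linarith)
    exact_mod_cast this

/-! ### Growth of Γ, ξ and Ξ -/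

theorem norm_Gamma_le {s : ℂ} (hs : 0 < s.re) : ‖Gamma s‖ ≤ Real.Gamma s.re :=
  le_of_tendsto (GammaSeq_tendsto_Gamma s).norm
    ((eventually_ne_atTop 0).mono fun _ hn => norm_GammaSeq_le hn hs)

/-- A crude form of Stirling: Γ(x) ≤ 4Γ(x + 2) moves the argument to where Γ increases, a factorial
bounds it by (x + 2)^{x+2}, and log y ≤ 2√y does the rest. An exponent below 2 is all that is needed
later. -/
theorem Gamma_le_exp {x : ℝ} (hx : 1 / 4 ≤ x) :
    Real.Gamma x ≤ 4 * Real.exp (2 * (x + 2) ^ (3 / 2 : ℝ)) := by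
  have hx0 : 0 < x := by linarith
  have h1 : Real.Gamma (x + 1) ≤ Real.Gamma (x + 2) := by
    have h := Real.Gamma_add_one (s := x + 1) (by positivity)
    have hp := Real.Gamma_pos_of_pos (s := x + 1) (by positivity)
    rw [show x + 1 + 1 = x + 2 by ring] at h
    nlinarith
  have h2 : Real.Gamma x ≤ 4 * Real.Gamma (x + 2) := by
    have h := Real.Gamma_add_one hx0.ne'
    have hp := Real.Gamma_pos_of_pos hx0
    nlinarith
  set k := ⌊x⌋₊ with hk
  have hk1 : x < k + 1 := Nat.lt_floor_add_one x
  have hk2 : (k : ℝ) ≤ x := Nat.floor_le hx0.le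
  have h3 : Real.Gamma (x + 2) ≤ Real.Gamma ((k + 2 : ℕ) + 1) := by
    refine Real.Gamma_strictMonoOn_Ici.monotoneOn ?_ ?_ ?_
    · simp only [Set.mem_Ici]; linarith
    · simp only [Set.mem_Ici]; push_cast; linarith [(k.cast_nonneg : (0 : ℝ) ≤ k)]
    · push_cast; linarith
  rw [Real.Gamma_nat_eq_factorial] at h3
  have h4 : ((k + 2).factorial : ℝ) ≤ (x + 2) ^ (x + 2) := by
    calc ((k + 2).factorial : ℝ) ≤ ((k + 2 : ℕ) : ℝ) ^ (k + 2) := by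
          exact_mod_cast Nat.factorial_le_pow _
      _ = ((k + 2 : ℕ) : ℝ) ^ ((k + 2 : ℕ) : ℝ) := (Real.rpow_natCast _ _).symm
      _ ≤ (x + 2) ^ ((k + 2 : ℕ) : ℝ) :=
          Real.rpow_le_rpow (by positivity) (by push_cast; linarith) (by positivity)
      _ ≤ (x + 2) ^ (x + 2) :=
          Real.rpow_le_rpow_of_exponent_le (by linarith) (by push_cast; linarith)
  have h5 : (x + 2) ^ (x + 2) ≤ Real.exp (2 * (x + 2) ^ (3 / 2 : ℝ)) := by
    have hy : 0 < x + 2 := by linarith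
    rw [Real.rpow_def_of_pos hy, Real.exp_le_exp]
    have := Real.log_le_rpow_div hy.le (ε := 1 / 2) (by norm_num)
    rw [show (3 / 2 : ℝ) = 1 / 2 + 1 by norm_num, Real.rpow_add hy, Real.rpow_one]
    nlinarith
  linarith

theorem norm_riemannXi_le {s : ℂ} (hs : 1 / 2 ≤ s.re) {T : ℝ} (hT : 1 ≤ T) (hsT : ‖s‖ ≤ T) :
    ‖riemannXi s‖ ≤ Real.exp (21 * T ^ (3 / 2 : ℝ)) := by
  have hre : 0 < s.re := by linarith
  have hJ : ‖fractIntegral s‖ ≤ 2 := (norm_fractIntegral_le hre).trans (by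
    rw [div_le_iff₀ hre]; linarith)
  have hsr : s.re ≤ T := (re_le_norm s).trans hsT
  have hT1 : T ≤ T ^ (3 / 2 : ℝ) := by
    simpa using Real.rpow_le_rpow_of_exponent_le hT (show (1 : ℝ) ≤ 3 / 2 by norm_num)
  -- Here 16 = 2 · 4^{3/2}, from Re(s)/2 + 2 ≤ 4T. The polynomial factors cost a further 5, giving
  -- 21.
  have hG : ‖Gammaℝ s‖ ≤ 4 * Real.exp (16 * T ^ (3 / 2 : ℝ)) := by
    have hs2 : (s / 2).re = s.re / 2 := by simp
    rw [Gammaℝ_def, norm_mul, norm_cpow_eq_rpow_re_of_pos Real.pi_pos]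
    have h1 : Real.pi ^ (-s / 2).re ≤ 1 := by
      refine Real.rpow_le_one_of_one_le_of_nonpos (by linarith [Real.pi_gt_three]) ?_
      rw [neg_div, neg_re, hs2]; linarith
    have h2 := norm_Gamma_le (s := s / 2) (by rw [hs2]; linarith)
    have h3 := Gamma_le_exp (x := (s / 2).re) (by rw [hs2]; linarith)
    refine (mul_le_of_le_one_left (norm_nonneg _) h1).trans (h2.trans (h3.trans ?_))
    have h4 : ((s / 2).re + 2) ^ (3 / 2 : ℝ) ≤ 8 * T ^ (3 / 2 : ℝ) := by
      have e : (4 : ℝ) ^ (3 / 2 : ℝ) = 8 := by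
        rw [show (4 : ℝ) = 2 ^ (2 : ℝ) by norm_num, ← Real.rpow_mul (by norm_num)]
        norm_num
      rw [← e, ← Real.mul_rpow (by norm_num) (by linarith)]
      refine Real.rpow_le_rpow ?_ ?_ (by norm_num) <;> rw [hs2] <;> linarith
    gcongr 4 * Real.exp ?_
    linarith
  have hP : ‖s - s * (s - 1) * fractIntegral s‖ ≤ 5 * T ^ 2 := by
    have h1 : ‖s - 1‖ ≤ T + 1 := (norm_sub_le _ _).trans (by simpa using hsT)
    calc _ ≤ ‖s‖ + ‖s‖ * ‖s - 1‖ * ‖fractIntegral s‖ := by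
          refine (norm_sub_le _ _).trans ?_
          rw [norm_mul, norm_mul]
      _ ≤ T + T * (T + 1) * 2 := by gcongr
      _ ≤ 5 * T ^ 2 := by nlinarith
  rw [riemannXi_eq_fractIntegral hre, norm_mul, norm_mul, norm_div, Complex.norm_ofNat]
  have hpoly : 10 * T ^ 3 ≤ Real.exp (5 * T) := by
    have h := Real.pow_div_factorial_le_exp (5 * T) (by linarith) 3
    have h6 : ((3 : ℕ).factorial : ℝ) = 6 := by norm_num [Nat.factorial]
    rw [h6] at h
    have : 0 < T ^ 3 := by positivity
    refine le_trans ?_ h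
    rw [le_div_iff₀ (by norm_num)]
    nlinarith
  calc _ ≤ T / 2 * (4 * Real.exp (16 * T ^ (3 / 2 : ℝ))) * (5 * T ^ 2) := by gcongr
    _ = 10 * T ^ 3 * Real.exp (16 * T ^ (3 / 2 : ℝ)) := by ring
    _ ≤ Real.exp (5 * T ^ (3 / 2 : ℝ)) * Real.exp (16 * T ^ (3 / 2 : ℝ)) := by
        gcongr
        exact hpoly.trans (Real.exp_le_exp.mpr (by linarith))
    _ = _ := by rw [← Real.exp_add]; ring_nf

theorem capitalXi_neg (t : ℂ) : capitalXi (-t) = capitalXi t := by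
  rw [capitalXi, capitalXi, ← riemannXi_one_sub]
  congr 1
  ring

/-- `Ξ` has order at most `3 / 2`. -/
theorem norm_capitalXi_le (t : ℂ) :
    ‖capitalXi t‖ ≤ Real.exp (21 * (1 + ‖t‖) ^ (3 / 2 : ℝ)) := by
  have hnorm : ∀ t : ℂ, ‖1 / 2 + I * t‖ ≤ 1 + ‖t‖ := fun t => by
    refine (norm_add_le _ _).trans ?_
    rw [norm_mul, norm_I, one_mul, norm_div, norm_one, Complex.norm_ofNat]
    linarith
  -- Im t ≤ 0 means Re(1/2 + it) ≥ 1/2; evenness covers the other half plane.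
  have key : ∀ t : ℂ, t.im ≤ 0 →
      ‖capitalXi t‖ ≤ Real.exp (21 * (1 + ‖t‖) ^ (3 / 2 : ℝ)) := fun t ht =>
    norm_riemannXi_le (by simp; linarith) (by linarith [norm_nonneg t]) (hnorm t)
  rcases le_total t.im 0 with h | h
  · exact key t h
  · have := key (-t) (by simpa using h)
    rwa [capitalXi_neg, norm_neg] at this

/-! ### Symmetry of the zeros of Ξ and the derivatives of Ξ'/Ξ -/

/-- A purely imaginary zero of Ξ would be a real zero of ξ. -/
theorem re_ne_zero_of_capitalXi_eq_zero {α : ℂ} (h : capitalXi α = 0) : α.re ≠ 0 := by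
  intro h0
  refine riemannXi_ofReal_ne_zero (1 / 2 - α.im) ?_
  rw [← h, capitalXi]
  congr 1
  apply Complex.ext <;> simp [h0, sub_eq_add_neg]

theorem iteratedDeriv_comp_mul_left (f : ℂ → ℂ) (c : ℂ) (n : ℕ) (z : ℂ) :
    iteratedDeriv n (fun z => f (c * z)) z = c ^ n * iteratedDeriv n f (c * z) := by
  induction n generalizing z with
  | zero => simp
  | succ n ih =>
    rw [iteratedDeriv_succ, funext ih, deriv_const_mul_field, deriv_comp_mul_left, ← iteratedDeriv_succ,
      smul_eq_mul]
    ring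

theorem analyticOrderNatAt_capitalXi_neg (α : ℂ) :
    analyticOrderNatAt capitalXi (-α) = analyticOrderNatAt capitalXi α := by
  have h := analyticOrderAt_comp_of_deriv_ne_zero (f := capitalXi) (g := fun t : ℂ => -t) (z₀ := α)
    analyticAt_id.neg (by simp)
  rw [show capitalXi ∘ (fun t : ℂ => -t) = capitalXi from funext capitalXi_neg] at h
  rw [analyticOrderNatAt, analyticOrderNatAt, h]

/-- The zeros of `Ξ` are symmetric about the origin, with multiplicities. -/
noncomputable def capitalXiZerosNeg : ZerosWithMult capitalXi ≃ ZerosWithMult capitalXi :=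
  Equiv.sigmaCongr
    ((Equiv.neg ℂ).subtypeEquiv fun α => by rw [Equiv.neg_apply, capitalXi_neg])
    fun α => finCongr (analyticOrderNatAt_capitalXi_neg α).symm

theorem capitalXiZerosNeg_fst (z : ZerosWithMult capitalXi) :
    ((capitalXiZerosNeg z).1 : ℂ) = -z.1 := rfl

/-- The zeros of `Ξ` in the right half plane. -/
def posXiZerosEquiv : {z : ZerosWithMult capitalXi | 0 < (z.1 : ℂ).re} ≃ PosXiZeros where
  toFun z := ⟨⟨z.1.1.1, z.1.1.2, z.2⟩, z.1.2⟩
  invFun z := ⟨⟨⟨z.1.1, z.1.2.1⟩, z.2⟩, z.1.2.2⟩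
  left_inv _ := rfl
  right_inv _ := rfl

/-- Zeros in the left half plane correspond to those in the right half plane. -/
noncomputable def compl_posXiZerosEquiv :
    ({z : ZerosWithMult capitalXi | 0 < (z.1 : ℂ).re}ᶜ : Set _) ≃
      {z : ZerosWithMult capitalXi | 0 < (z.1 : ℂ).re} :=
  capitalXiZerosNeg.subtypeEquiv fun z => by
    -- Without zeros on the imaginary axis, Re ≤ 0 is the same as Re < 0, so negation swaps the two
    -- halves.
    have h := re_ne_zero_of_capitalXi_eq_zero z.1.2
    simp only [Set.mem_compl_iff, Set.mem_ofPred_eq, capitalXiZerosNeg_fst, neg_re, not_lt,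
      Left.neg_pos_iff]
    exact ⟨fun h' => lt_of_le_of_ne h' h, le_of_lt⟩

/-- Sums of even functions over the zeros of `Ξ`. -/
theorem hasSum_posXiZeros {φ : ℂ → ℂ} (hφ : ∀ z, φ (-z) = φ z) {s : ℂ}
    (h : HasSum (fun z : ZerosWithMult capitalXi => φ z.1) s) :
    HasSum (fun z : PosXiZeros => φ z.1) (s / 2) := by
  set A := {z : ZerosWithMult capitalXi | 0 < (z.1 : ℂ).re}
  have hA : Summable fun z : A => φ z.1.1 := h.summable.subtype A
  have hpos : Summable fun z : PosXiZeros => φ z.1 := posXiZerosEquiv.summable_iff.mp hA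
  have h1 : ∑' z : A, φ z.1.1 = ∑' z : PosXiZeros, φ z.1 :=
    posXiZerosEquiv.tsum_eq fun z : PosXiZeros => φ z.1
  have h2 : ∑' z : (Aᶜ : Set _), φ z.1.1 = ∑' z : A, φ z.1.1 := by
    rw [← compl_posXiZerosEquiv.tsum_eq fun z : A => φ z.1.1]
    exact tsum_congr fun z => (hφ z.1.1).symm
  have h3 := h.summable.tsum_subtype_add_tsum_subtype_compl A
  rw [h2, h1, h.tsum_eq] at h3
  rw [← h3, add_self_div_two]
  exact hpos.hasSum

theorem capitalXi_zero_ne_zero : capitalXi 0 ≠ 0 := fun h =>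
  re_ne_zero_of_capitalXi_eq_zero h zero_re

/-- The Taylor coefficients of `Ξ'/Ξ` at the origin. -/
theorem hasSum_posXiZeros_one_div_pow {n : ℕ} (hn : 2 ≤ n) (he : Even n) :
    HasSum (fun z : PosXiZeros => 1 / (z.1 : ℂ) ^ n)
      (-(iteratedDeriv (n - 1) (logDeriv capitalXi) 0 / (n - 1).factorial) / 2) := by
  have hn' : n - 1 + 1 = n := by lia
  have h := hasSum_iteratedDeriv_logDeriv differentiable_capitalXi capitalXi_zero_ne_zero
    (by norm_num) norm_capitalXi_le (n := n - 1) (by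
      rw [hn']
      have : (2 : ℝ) ≤ n := by exact_mod_cast hn
      linarith)
  rw [hn'] at h
  exact hasSum_posXiZeros (φ := fun z => 1 / z ^ n) (fun z => by rw [he.neg_pow]) h

/-- Ξ is even, so Ξ'/Ξ is odd and its even derivatives at 0 equal their own negatives. -/
theorem iteratedDeriv_logDeriv_capitalXi_of_even {m : ℕ} (hm : Even m) :
    iteratedDeriv m (logDeriv capitalXi) 0 = 0 := by
  have hodd : (fun t => logDeriv capitalXi (-t)) = -logDeriv capitalXi := by
    ext t
    have h := deriv_comp_neg capitalXi t
    simp only [capitalXi_neg] at h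
    simp only [Pi.neg_apply, logDeriv_apply, capitalXi_neg]
    change deriv capitalXi t = _ at h
    rw [h]; ring
  have h := iteratedDeriv_comp_neg m (logDeriv capitalXi) 0
  rw [hodd, iteratedDeriv_neg, hm.neg_one_pow, neg_zero, one_smul] at h
  linear_combination (-1 / 2 : ℂ) * h

theorem iteratedDeriv_logDeriv_capitalXi (m : ℕ) :
    iteratedDeriv m (logDeriv capitalXi) 0 =
      I ^ (m + 1) * iteratedDeriv m (logDeriv riemannXi) (1 / 2) := by
  have h : logDeriv capitalXi = fun t => I * logDeriv riemannXi (1 / 2 + I * t) := by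
    ext t
    have hd : HasDerivAt (fun t : ℂ => 1 / 2 + I * t) I t := by
      simpa using ((hasDerivAt_id t).const_mul I).const_add (1 / 2)
    have := logDeriv_comp (f := riemannXi) (g := fun t : ℂ => 1 / 2 + I * t) (x := t)
      (differentiable_riemannXi _) hd.differentiableAt
    rw [hd.deriv] at this
    rw [mul_comm, ← this]
    rfl
  rw [h, iteratedDeriv_const_mul_field,
    iteratedDeriv_comp_mul_left (fun w => logDeriv riemannXi (1 / 2 + w)),
    iteratedDeriv_comp_const_add]
  simp only [mul_zero, add_zero]
  ring

/-! ### The logarithmic derivative of ζ at 1/2 -/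

theorem riemannZeta_one_half_ne_zero : riemannZeta (1 / 2) ≠ 0 := by
  intro h
  have h1 := riemannXi_ofReal_ne_zero (1 / 2)
  push_cast at h1
  rw [riemannXi_eq_Gammaℝ_mul (by norm_num) (by norm_num), h, mul_zero] at h1
  exact h1 rfl

theorem logDeriv_Gammaℝ {s : ℂ} (hs : 0 < s.re) :
    logDeriv Gammaℝ s = -(Complex.log Real.pi / 2) + 1 / 2 * digamma (1 / 2 * s) := by
  have hπ : (Real.pi : ℂ) ≠ 0 := ofReal_ne_zero.mpr Real.pi_ne_zero
  have hs2 : 0 < (1 / 2 * s).re := by simpa using hs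
  have h1 : HasDerivAt (fun z : ℂ => (Real.pi : ℂ) ^ (-z / 2))
      ((Real.pi : ℂ) ^ (-s / 2) * Complex.log Real.pi * (-1 / 2)) s :=
    ((hasDerivAt_id s).neg.div_const 2).const_cpow (Or.inl hπ)
  have hd : HasDerivAt (fun z : ℂ => 1 / 2 * z) (1 / 2) s := by
    simpa only [mul_one] using (hasDerivAt_id' s).const_mul (1 / 2 : ℂ)
  have hG := differentiableAt_Gamma_of_re_pos hs2
  have h2 : logDeriv (fun z : ℂ => Gamma (1 / 2 * z)) s = digamma (1 / 2 * s) * (1 / 2) := by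
    have := logDeriv_comp (f := Gamma) (g := fun z : ℂ => 1 / 2 * z) hG hd.differentiableAt
    rwa [hd.deriv] at this
  have hne : (Real.pi : ℂ) ^ (-s / 2) ≠ 0 := by simp [cpow_eq_zero_iff, hπ]
  have hfun : Gammaℝ = fun z => (Real.pi : ℂ) ^ (-z / 2) * Gamma (1 / 2 * z) := by
    ext z
    rw [Gammaℝ_def, show z / 2 = 1 / 2 * z by ring]
  rw [hfun, logDeriv_mul (g := fun z => Gamma (1 / 2 * z)) s hne
    (Gamma_ne_zero_of_re_pos hs2) h1.differentiableAt
    (hG.comp s (f := fun z : ℂ => 1 / 2 * z) hd.differentiableAt), h2, logDeriv_apply, h1.deriv]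
  field_simp

/-- The logarithmic derivative of `ζ` near `1/2`. -/
theorem logDeriv_riemannZeta_eventuallyEq :
    (fun s : ℂ => deriv riemannZeta s / riemannZeta s) =ᶠ[𝓝 (1 / 2)] fun s =>
      logDeriv riemannXi s + (Complex.log Real.pi / 2 - ((s + 0)⁻¹ + (s + -1)⁻¹ +
        1 / 2 * digamma (1 / 2 * s))) := by
  have hz : ContinuousAt riemannZeta (1 / 2) :=
    (differentiableAt_riemannZeta (by norm_num)).continuousAt
  filter_upwards [hz.eventually_ne riemannZeta_one_half_ne_zero,
    (isOpen_lt continuous_const continuous_re).mem_nhds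
      (show (1 / 2 : ℂ) ∈ {s : ℂ | 0 < s.re} by simp),
    isOpen_ne.mem_nhds (show (1 / 2 : ℂ) ≠ 1 by norm_num)] with s hζ hs h1
  have hs0 : s ≠ 0 := by rintro rfl; simp at hs
  have hs1 : s - 1 ≠ 0 := sub_ne_zero.mpr h1
  have hev : riemannXi =ᶠ[𝓝 s] fun s => s * (s - 1) / 2 * Gammaℝ s * riemannZeta s := by
    filter_upwards [(isOpen_lt continuous_const continuous_re).mem_nhds hs,
      isOpen_ne.mem_nhds h1] with z hz hz1 using riemannXi_eq_Gammaℝ_mul hz1 hz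
  have hGd := differentiableAt_Gammaℝ hs
  have hG := Gammaℝ_ne_zero_of_re_pos hs
  have hp : s * (s - 1) / 2 ≠ 0 := div_ne_zero (mul_ne_zero hs0 hs1) two_ne_zero
  have e1 : logDeriv riemannXi s =
      logDeriv (fun s => s * (s - 1) / 2 * Gammaℝ s * riemannZeta s) s := by
    rw [logDeriv_apply, logDeriv_apply, hev.deriv_eq, hev.self_of_nhds]
  have e2 : logDeriv (fun s : ℂ => s * (s - 1) / 2) s = s⁻¹ + (s - 1)⁻¹ := by
    have hd : HasDerivAt (fun s : ℂ => s * (s - 1) / 2) ((1 * (s - 1) + s * 1) / 2) s :=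
      ((hasDerivAt_id s).mul ((hasDerivAt_id s).sub_const 1)).div_const 2
    rw [logDeriv_apply, hd.deriv]
    field_simp
  rw [e1, logDeriv_mul (f := fun s => s * (s - 1) / 2 * Gammaℝ s) s (mul_ne_zero hp hG) hζ
    (by fun_prop) (differentiableAt_riemannZeta h1),
    logDeriv_mul (f := fun s => s * (s - 1) / 2) s hp hG (by fun_prop) hGd, e2, logDeriv_Gammaℝ hs, logDeriv_apply, add_zero,
    ← sub_eq_add_neg s]
  ring

/-- The derivatives of `ζ'/ζ` at `1/2`. -/
theorem iteratedDeriv_logDeriv_riemannZeta {m : ℕ} (hm : m ≠ 0) :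
    iteratedDeriv m (fun s : ℂ => deriv riemannZeta s / riemannZeta s) (1 / 2) =
      iteratedDeriv m (logDeriv riemannXi) (1 / 2) -
        ((-1) ^ m - 1) * m.factorial * 2 ^ (m + 1) -
          (1 / 2) ^ (m + 1) * iteratedDeriv m digamma (1 / 4) := by
  have hξ : AnalyticAt ℂ (logDeriv riemannXi) (1 / 2) := by
    refine (differentiable_riemannXi.analyticAt _).deriv.div (differentiable_riemannXi.analyticAt _) ?_
    have := riemannXi_ofReal_ne_zero (1 / 2)
    push_cast at this
    exact this
  have hinv : ∀ c : ℂ, 1 / 2 + c ≠ 0 → ContDiffAt ℂ m (fun s : ℂ => (s + c)⁻¹) (1 / 2) :=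
    fun c hc => (contDiffAt_id.add contDiffAt_const).inv hc
  have h0 := hinv 0 (by norm_num)
  have h1 := hinv (-1) (by norm_num)
  have hψ : ContDiffAt ℂ m (fun s : ℂ => 1 / 2 * digamma (1 / 2 * s)) (1 / 2) := by
    have ho : IsOpen {z : ℂ | 0 < z.re} := isOpen_lt continuous_const continuous_re
    have hA : AnalyticAt ℂ digamma (1 / 2 * (1 / 2)) :=
      differentiableOn_digamma.analyticAt (ho.mem_nhds (by simp))
    exact contDiffAt_const.mul (hA.contDiffAt.comp (1 / 2 : ℂ) (f := fun s : ℂ => 1 / 2 * s)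
      (contDiffAt_const.mul contDiffAt_id))
  rw [logDeriv_riemannZeta_eventuallyEq.iteratedDeriv_eq m,
    iteratedDeriv_fun_add hξ.contDiffAt (contDiffAt_const.sub ((h0.add h1).add hψ)),
    iteratedDeriv_const_sub (Nat.pos_of_ne_zero hm), iteratedDeriv_neg,
    iteratedDeriv_fun_add (h0.add h1) hψ, iteratedDeriv_fun_add h0 h1, iteratedDeriv_inv_add,
    iteratedDeriv_inv_add, iteratedDeriv_const_mul_field, iteratedDeriv_comp_mul_left,
    show (1 / 2 + -1 : ℂ) = -1 * (1 / 2) by norm_num, mul_pow, pow_succ (-1 : ℂ),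
    show (1 / 2 * (1 / 2) : ℂ) = 1 / 4 by norm_num]
  -- The poles at 0 and 1 contribute inverse powers of 1/2 and -1/2; parity decides between
  -- cancellation and doubling.
  have h2 : ((-1 : ℂ) ^ m) * (-1) ^ m = 1 := by rw [← mul_pow]; simp
  have h3 : ((-1 : ℂ) ^ m) ≠ 0 := pow_ne_zero _ (by norm_num)
  have h4 : (1 : ℂ) / ((-1) ^ m * -1 * (1 / 2) ^ (m + 1)) = -((-1) ^ m * 2 ^ (m + 1)) := by
    rw [div_pow, one_pow]
    field_simp
    linear_combination h2
  have h5 : (1 : ℂ) / (1 / 2 + 0) ^ (m + 1) = 2 ^ (m + 1) := by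
    rw [add_zero, div_pow, one_pow, one_div_one_div]
  rw [h4, h5]
  linear_combination (m.factorial * 2 ^ (m + 1) : ℂ) * h2

/-! ### Values at 1/4 and the final identities -/

/-- The sum over the residue class `1` modulo `4` in terms of `ζ` and `L(·, χ)`. -/
theorem hasSum_one_div_four_mul_add_one_pow {n : ℕ} (hn : 2 ≤ n) :
    HasSum (fun k : ℕ => 1 / (4 * (k : ℂ) + 1) ^ n)
      (((1 - 1 / 2 ^ n) * riemannZeta n + DirichletCharacter.LFunction chi4 n) / 2) := by
  have hn0 : n ≠ 0 := by lia
  have hn1 : 1 < n := by lia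
  have hre : 1 < ((n : ℕ) : ℂ).re := by simpa using hn1
  set a : ℕ → ℂ := fun k => 1 / (k : ℂ) ^ n with ha
  have hodd : Function.Injective fun k : ℕ => 2 * k + 1 := fun x y h => by simpa using h
  have heven : Function.Injective fun k : ℕ => 2 * k := fun x y h => by simpa using h
  have hsa : Summable a := by
    refine Summable.of_norm ?_
    simpa [ha] using Real.summable_nat_pow_inv.mpr hn1
  have hζ : HasSum a (riemannZeta n) := by
    rw [zeta_nat_eq_tsum_of_gt_one hn1]
    exact hsa.hasSum
  have hc := hsa.comp_injective hodd
  have hp := hc.comp_injective heven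
  have hq := hc.comp_injective hodd
  simp only [Function.comp_def] at hc hp hq
  have h1 : riemannZeta n = riemannZeta n / 2 ^ n + ∑' k, a (2 * k + 1) := by
    refine hζ.unique (HasSum.even_add_odd ?_ hc.hasSum)
    refine (hζ.div_const (2 ^ n)).congr_fun fun k => ?_
    simp only [ha]
    push_cast
    rw [mul_pow, div_div, mul_comm]
  have h2 : ∑' k, a (2 * k + 1) = ∑' k, a (2 * (2 * k) + 1) + ∑' k, a (2 * (2 * k + 1) + 1) :=
    (tsum_even_add_odd (f := fun k => a (2 * k + 1)) hp hq).symm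
  have hL : HasSum (LSeries.term (fun k : ℕ => chi4 (k : ZMod 4)) n)
      (DirichletCharacter.LFunction chi4 n) := by
    rw [DirichletCharacter.LFunction_eq_LSeries chi4 hre]
    exact (DirichletCharacter.LSeriesSummable_of_one_lt_re chi4 hre).LSeriesHasSum
  have hterm : ∀ k : ℕ, LSeries.term (fun k : ℕ => chi4 (k : ZMod 4)) n k = chi4 (k : ZMod 4) * a k := by
    intro k
    rcases eq_or_ne k 0 with rfl | hk
    · simp [ha, hn0]
    · rw [LSeries.term_of_ne_zero hk, cpow_natCast, ha, mul_one_div]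
  rw [funext hterm] at hL
  have hχ0 : ∀ k : ℕ, chi4 ((2 * k : ℕ) : ZMod 4) = 0 := fun k => by
    have : (2 * k) % 2 = 0 := by lia
    rw [MulChar.ringHomComp_apply, ZMod.χ₄_nat_eq_if_mod_four, if_pos this, map_zero]
  have hχ1 : ∀ k : ℕ, chi4 ((2 * (2 * k) + 1 : ℕ) : ZMod 4) = 1 := fun k => by
    rw [MulChar.ringHomComp_apply, ZMod.χ₄_nat_one_mod_four (by lia), map_one]
  have hχ3 : ∀ k : ℕ, chi4 ((2 * (2 * k + 1) + 1 : ℕ) : ZMod 4) = -1 := fun k => by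
    rw [MulChar.ringHomComp_apply, ZMod.χ₄_nat_three_mod_four (by lia), map_neg, map_one]
  -- Splitting by residues modulo 4: χ is 0 on even integers, 1 on the class of 1 and -1 on the
  -- class of 3.
  have h3 : DirichletCharacter.LFunction chi4 n =
      0 + (∑' k, a (2 * (2 * k) + 1) + -∑' k, a (2 * (2 * k + 1) + 1)) := by
    refine hL.unique (HasSum.even_add_odd ?_ (HasSum.even_add_odd ?_ ?_))
    · simp only [hχ0, zero_mul]
      exact hasSum_zero
    · simp only [hχ1, one_mul]
      exact hp.hasSum
    · simp only [hχ3, neg_one_mul]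
      exact hq.hasSum.neg
  have h4 : ((1 - 1 / 2 ^ n) * riemannZeta n + DirichletCharacter.LFunction chi4 n) / 2 =
      ∑' k, a (2 * (2 * k) + 1) := by
    rw [h2] at h1
    linear_combination (1 / 2 : ℂ) * h1 + (1 / 2 : ℂ) * h3
  rw [h4]
  refine hp.hasSum.congr_fun fun k => ?_
  simp only [ha]
  push_cast
  ring

theorem iteratedDeriv_digamma_one_div_four {n : ℕ} (hn : 2 ≤ n) :
    iteratedDeriv (n - 1) digamma (1 / 4) = (-1) ^ n * (n - 1).factorial * 4 ^ n *
      (((1 - 1 / 2 ^ n) * riemannZeta n + DirichletCharacter.LFunction chi4 n) / 2) := by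
  have h := hasSum_iteratedDeriv_digamma (a := 1 / 4) (by norm_num) (m := n - 1) (by lia)
  rw [show n - 1 + 1 = n by lia] at h
  refine h.unique (((hasSum_one_div_four_mul_add_one_pow hn).mul_left
    ((-1) ^ n * ((n - 1).factorial : ℂ) * 4 ^ n)).congr_fun fun k => ?_)
  rw [show (1 / 4 + k : ℂ) = (4 * k + 1) / 4 by ring, div_pow, one_div_div]
  ring

theorem mainTheorem3 :
    -- the logarithmic derivative of `ζ` is regular at `1/2`
    riemannZeta (1 / 2) ≠ 0 ∧
    (∀ n : ℕ, 3 ≤ n → Odd n →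
      1 / (((n - 1).factorial : ℂ) * 2 ^ (n - 1)) *
          iteratedDeriv (n - 1) (fun s : ℂ => deriv riemannZeta s / riemannZeta s) (1 / 2) =
        (1 - 1 / 2 ^ n) * riemannZeta n + DirichletCharacter.LFunction chi4 n) ∧
    (∀ n : ℕ, 2 ≤ n → Even n →
      Summable (fun z : PosXiZeros => 4 / (z.1 : ℂ) ^ n) ∧
      1 / (((n - 1).factorial : ℂ) * 2 ^ (n - 1)) *
          iteratedDeriv (n - 1) (fun s : ℂ => deriv riemannZeta s / riemannZeta s) (1 / 2) =
        4 - (-1) ^ (n / 2) / 2 ^ n * ∑' z : PosXiZeros, 4 / (z.1 : ℂ) ^ n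
          - DirichletCharacter.LFunction chi4 n - (1 - 1 / 2 ^ n) * riemannZeta n) := by
  have hhalf : ∀ n : ℕ, (1 / 2 : ℂ) ^ n * 4 ^ n = 2 ^ n := fun n => by
    rw [← mul_pow]; norm_num
  refine ⟨riemannZeta_one_half_ne_zero, fun n hn hodd => ?_, fun n hn he => ?_⟩
  · have hfac : ((n - 1).factorial : ℂ) ≠ 0 := Nat.cast_ne_zero.mpr (n - 1).factorial_ne_zero
    have hn1 : n - 1 + 1 = n := by lia
    have hm : Even (n - 1) := by
      rw [Nat.even_sub' (by lia)]
      simp [hodd]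
    have hΞ := iteratedDeriv_logDeriv_capitalXi (n - 1)
    rw [iteratedDeriv_logDeriv_capitalXi_of_even hm, eq_comm, mul_eq_zero] at hΞ
    have hξ := hΞ.resolve_left (pow_ne_zero _ I_ne_zero)
    rw [iteratedDeriv_logDeriv_riemannZeta (by lia), hξ, iteratedDeriv_digamma_one_div_four (by lia),
      hm.neg_one_pow, hn1, hodd.neg_one_pow]
    have h2 : (2 : ℂ) ^ n = 2 ^ (n - 1) * 2 := by rw [← pow_succ, hn1]
    rw [one_div_mul_eq_div, div_eq_iff (mul_ne_zero hfac (pow_ne_zero _ two_ne_zero))]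
    linear_combination ((n - 1).factorial * (((1 - 1 / 2 ^ n) * riemannZeta n +
      DirichletCharacter.LFunction chi4 n) / 2) : ℂ) * (hhalf n + h2)
  · have hfac : ((n - 1).factorial : ℂ) ≠ 0 := Nat.cast_ne_zero.mpr (n - 1).factorial_ne_zero
    have hn1 : n - 1 + 1 = n := by lia
    have hm : Odd (n - 1) := by
      rw [Nat.odd_sub' (by lia)]
      simp [he]
    have hsum := (hasSum_posXiZeros_one_div_pow hn he).mul_left 4
    simp only [mul_one_div] at hsum
    refine ⟨hsum.summable, ?_⟩
    rw [hsum.tsum_eq, iteratedDeriv_logDeriv_capitalXi, hn1,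
      iteratedDeriv_logDeriv_riemannZeta (by lia), iteratedDeriv_digamma_one_div_four hn,
      hm.neg_one_pow, hn1, he.neg_one_pow]
    obtain ⟨k, rfl⟩ := he
    have hI : I ^ (k + k) = (-1) ^ k := by rw [← two_mul, pow_mul, I_sq]
    have hk : (k + k) / 2 = k := by lia
    have h1 : ((-1 : ℂ) ^ k) * (-1) ^ k = 1 := by rw [← mul_pow]; simp
    rw [hI, hk]
    set D := iteratedDeriv (k + k - 1) (logDeriv riemannXi) (1 / 2)
    set A := ((1 - 1 / 2 ^ (k + k)) * riemannZeta (k + k : ℕ) +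
      DirichletCharacter.LFunction chi4 (k + k : ℕ)) / 2 with hA
    have h2 : (2 : ℂ) ^ (k + k) = 2 ^ (k + k - 1) * 2 := by rw [← pow_succ, hn1]
    have h3 : (2 : ℂ) ^ (k + k - 1) ≠ 0 := pow_ne_zero _ two_ne_zero
    -- The sign (-1)^{n/2} in the statement undoes I^n, the factor from passing between derivatives
    -- of ξ'/ξ and Ξ'/Ξ.
    have h4 : (-1 : ℂ) ^ k / 2 ^ (k + k) *
        (4 * (-((-1) ^ k * D / (k + k - 1).factorial) / 2)) =
        -(D / ((k + k - 1).factorial * 2 ^ (k + k - 1))) := by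
      rw [h2]
      field_simp
      linear_combination (-4 * D) * h1
    rw [h4]
    have h5 : (1 / 2 : ℂ) ^ (k + k) * (1 * (k + k - 1).factorial * 4 ^ (k + k) * A) =
        (k + k - 1).factorial * 2 ^ (k + k - 1) * (2 * A) := by
      linear_combination ((k + k - 1).factorial * A) * (hhalf (k + k) + h2)
    have h6 : (-1 - 1 : ℂ) * (k + k - 1).factorial * 2 ^ (k + k) =
        (k + k - 1).factorial * 2 ^ (k + k - 1) * (-4) := by
      rw [h2]; ring
    rw [h5, h6]
    have h7 : 4 - -(D / ((k + k - 1).factorial * 2 ^ (k + k - 1))) -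
        DirichletCharacter.LFunction chi4 (k + k : ℕ) - (1 - 1 / 2 ^ (k + k)) *
          riemannZeta (k + k : ℕ) = 4 + D / ((k + k - 1).factorial * 2 ^ (k + k - 1)) - 2 * A := by
      rw [hA]; ring
    rw [h7]
    field_simp
    ring
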